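/- Let $s\ge 2$ be an integer, let $\mathbb Z_s=\{\sum_{j\ge0}x_js^j: 0\le x_j\le s-1\}$ be the space of $s$-adic integers (with the product topology of the digits; it contains $\mathbb Z_{\ge0}$ through base-$s$ expansions), let $\mathcal V=\{(n,x): n\in\mathbb Z_{\ge0},\ 0\le x<s^n\}$, and let $H=\ell^2(\mathcal V)$ with canonical basis $\{E_{(n,x)}\}$. For a bounded function $F:\mathcal V\to\mathbb C$ let $M_F E_{(n,x)}=F(n,x)E_{(n,x)}$, and for $f\in C(\mathbb Z_s)$ let $M_fE_{(n,x)}=f(x)E_{(n,x)}$. The Serre shift is the isometry $$W E_{(n,x)}=\frac1{\sqrt s}\sum_{j=0}^{s-1}E_{(n+1,\,x+js^n)},$$ and the Serre shift algebra is $A_W=C^*(W,M_f: f\in C(\mathbb Z_s))\subseteq B(H)$. Let $\mathcal F$ be the set of all $F:\mathcal V\to\mathbb C$ for which there is $f_F\in C(\mathbb Z_s)$ with $\lim_{n\to\infty}\sup_{0\le x<s^n}|F(n,x)-f_F(x)|=0$ (such $F$ are bounded), let $\mathcal P_n=W^n(I-WW^*)(W^*)^n$ for $n\ge 0$, and let $B_W=C^*(M_F,\mathcal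 P_n: F\in\mathcal F,\ n\ge0)$. For $\theta\in\mathbb R/\mathbb Z$ let $\rho_\theta(a)=\mathcal U_\theta a\,\mathcal U_\theta^{-1}$, where $\mathcal U_\theta E_{(n,x)}=e^{2\pi i n\theta}E_{(n,x)}$. For a unital C$^*$-algebra $A$ and a (not necessarily unital) endomorphism $\alpha$ of $A$, let $A\rtimes_\alpha\mathbb N$ be the universal unital C$^*$-algebra generated by a (unital) copy of $A$ and an isometry $\mathcal J$ subject to $\alpha(a)=\mathcal J a\mathcal J^*$, $a\in A$. **Theorem.** $B_W$ is the gauge-invariant subalgebra of $A_W$, that is, $B_W=\{a\in A_W:\rho_\theta(a)=a\text{ for all }\theta\}$; the formula $\alpha_W(b)=WbW^*$ defines an endomorphism $\alpha_W$ of $B_W$; and there is an isomorphism of C$^*$-algebras $$A_W\;\cong\;B_W\rtimes_{\alpha_W}\mathbb N ,$$ which sends each $b\in B_W$ to its canonical image and $W$ to the canonical isometry $\mathcal J$. -/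

import Mathlib

open scoped ENNReal Topology

noncomputable section

/-! ### Stacey's crossed product by an endomorphism -/

universe u

/-- A (non-zero) covariant representation of `(A, α)`, where `A` is a unital C⋆-algebra and `α` is a
(not necessarily unital) endomorphism of `A`: a unital C⋆-algebra `C`, a unital ⋆-homomorphism
`π : A → C` and an isometry `J ∈ C` such that `π (α a) = J π(a) J⋆` for all `a ∈ A`. -/
structure CovariantRep {A : Type u} [CStarAlgebra A] (α : A →⋆ₙₐ[ℂ] A) : Type (u + 1) where
  C : Type u
  [cstar : CStarAlgebra C]
  [nontriv : Nontrivial C]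
  π : A →⋆ₐ[ℂ] C
  J : C
  isometry : star J * J = 1
  covariant : ∀ a : A, π (α a) = J * π a * star J

attribute [instance] CovariantRep.cstar CovariantRep.nontriv

/-- The `ℓ^∞`-direct product of unital C⋆-algebras is a unital C⋆-algebra. -/
instance lpInftyCStarAlgebra {I : Type*} {C : I → Type*} [∀ i, Nontrivial (C i)]
    [∀ i, CStarAlgebra (C i)] : CStarAlgebra (lp C ∞) where

namespace CrossedProduct

variable {A : Type u} [CStarAlgebra A] (α : A →⋆ₙₐ[ℂ] A)

/-- The C⋆-algebraic direct product of the targets of all covariant representations. -/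
abbrev Ambient : Type (u + 1) := lp (fun r : CovariantRep α => r.C) ∞

/-- The tuple `(π_r a)_r`. -/
def iotaFun (a : A) : Ambient α :=
  ⟨fun r => r.π a, memℓp_infty ⟨‖a‖, by
    rintro _ ⟨r, rfl⟩
    exact NonUnitalStarAlgHom.norm_apply_le r.π a⟩⟩

/-- The tuple `(J_r)_r`. -/
def isoElem : Ambient α :=
  ⟨fun r => r.J, memℓp_infty ⟨1, by
    rintro _ ⟨r, rfl⟩
    have h : ‖r.J‖ * ‖r.J‖ = 1 := by
      rw [← CStarRing.norm_star_mul_self, r.isometry, norm_one]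
    have h0 := norm_nonneg r.J
    show ‖r.J‖ ≤ 1
    nlinarith⟩⟩

/-- The C⋆-algebra generated by the tuples `(π_r a)_r`, `a ∈ A`, and `(J_r)_r`. -/
def algebra : StarSubalgebra ℂ (Ambient α) :=
  (StarAlgebra.adjoin ℂ (insert (isoElem α) (Set.range (iotaFun α)))).topologicalClosure

instance : IsClosed (algebra α : Set (Ambient α)) :=
  StarSubalgebra.isClosed_topologicalClosure _

end CrossedProduct

/-- The crossed product `A ⋊_α ℕ`: the universal unital C⋆-algebra generated by a (unital) copy of
`A` and an isometry `J` subject to `α(a) = J a J⋆`.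

It is built in the usual way, as the C⋆-subalgebra generated by `A` and `J` in the product of all
covariant representations of `(A, α)`. Targets in the universe of `A` suffice: the image
of `A` and the isometry generate a C⋆-algebra of cardinality at most `(#A + ℵ₀) ^ ℵ₀`, and this has
a copy in the universe of `A`. The zero algebra may be left out, as it does not contribute to the
norm. -/
abbrev CrossedProduct {A : Type u} [CStarAlgebra A] (α : A →⋆ₙₐ[ℂ] A) : Type (u + 1) :=
  CrossedProduct.algebra α

namespace CrossedProduct

variable {A : Type u} [CStarAlgebra A] (α : A →⋆ₙₐ[ℂ] A)

/-- The canonical image of `a ∈ A` in `A ⋊_α ℕ`. -/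
def iota (a : A) : CrossedProduct α :=
  ⟨iotaFun α a, StarSubalgebra.le_topologicalClosure _
    (StarAlgebra.subset_adjoin ℂ _ (Set.mem_insert_of_mem _ ⟨a, rfl⟩))⟩

/-- The canonical isometry `J ∈ A ⋊_α ℕ`. -/
def iso : CrossedProduct α :=
  ⟨isoElem α, StarSubalgebra.le_topologicalClosure _
    (StarAlgebra.subset_adjoin ℂ _ (Set.mem_insert _ _))⟩

end CrossedProduct

/-! ### The `s`-adic tree, its Hilbert space and the Serre shift -/

namespace SerreShift

/-- The space `ℤ_s` of `s`-adic integers `∑ x_j s^j`, `0 ≤ x_j ≤ s - 1`, given by the sequences of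
their digits, with the product topology. -/
abbrev SAdic (s : ℕ) : Type := ℕ → Fin s

/-- The natural number `x` as an `s`-adic integer: its `j`-th digit is `⌊x / s^j⌋ mod s`. -/
def ofNat (s : ℕ) [NeZero s] (x : ℕ) : SAdic s := fun j => Fin.ofNat s (x / s ^ j)

/-- The vertices `(n, x)`, `0 ≤ x < s^n`, of the `s`-adic tree. -/
abbrev Vertex (s : ℕ) : Type := Σ n : ℕ, Fin (s ^ n)

/-- The Hilbert space `H = ℓ²(𝒱)`. -/
abbrev Hil (s : ℕ) : Type := lp (fun _ : Vertex s => ℂ) 2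

/-- The canonical basis vector `E_{(n,x)}`. -/
def basisVec {s : ℕ} (v : Vertex s) : Hil s := lp.single 2 v (1 : ℂ)

/-- The diagonal operator `M_F E_{(n,x)} = F(n,x) E_{(n,x)}` for a bounded function `F` on `𝒱`. -/
def diagOp {s : ℕ} (F : lp (fun _ : Vertex s => ℂ) ∞) : Hil s →L[ℂ] Hil s :=
  lp.mapCLM 2 (fun v => F v • ContinuousLinearMap.id ℂ ℂ) (norm_nonneg F) fun v => by
    rw [norm_smul, ContinuousLinearMap.norm_id, mul_one]
    exact lp.norm_apply_le_norm ENNReal.top_ne_zero F v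

/-- For `f ∈ C(ℤ_s)`, the bounded function `(n, x) ↦ f(x)` on `𝒱`. -/
def pullback {s : ℕ} [NeZero s] (f : C(SAdic s, ℂ)) : lp (fun _ : Vertex s => ℂ) ∞ :=
  ⟨fun v => f (ofNat s v.2), memℓp_infty ⟨‖f‖, by
    rintro _ ⟨v, rfl⟩
    exact f.norm_coe_le_norm _⟩⟩

/-- The vertex `(n + 1, x + j s^n)`, an immediate successor of `(n, x)`. -/
def child {s : ℕ} (v : Vertex s) (j : Fin s) : Vertex s :=
  ⟨v.1 + 1, ⟨v.2 + j * s ^ v.1, by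
    have h1 := v.2.isLt
    have h2 : ((j : ℕ) + 1) * s ^ v.1 ≤ s * s ^ v.1 := Nat.mul_le_mul_right _ j.isLt
    rw [pow_succ']
    linarith⟩⟩

theorem child_inj {s : ℕ} {v w : Vertex s} {i j : Fin s} (h : child v i = child w j) :
    v = w ∧ i = j := by
  obtain ⟨n, x⟩ := v
  obtain ⟨m, y⟩ := w
  obtain rfl : n = m := Nat.succ_injective (congrArg Sigma.fst h)
  have h' : (x : ℕ) + i * s ^ n = y + j * s ^ n := by
    simpa [child] using h
  have hx := x.isLt
  have hy := y.isLt
  have h1 : (x : ℕ) = y := by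
    have := congrArg (· % s ^ n) h'
    simpa [Nat.mod_eq_of_lt hx, Nat.mod_eq_of_lt hy] using this
  have h2 : (i : ℕ) = j := by
    rw [h1] at h'
    exact Nat.eq_of_mul_eq_mul_right (by omega) (Nat.add_left_cancel h')
  exact ⟨by rw [Fin.ext h1], Fin.ext h2⟩

/-- The vector `W E_{(n,x)} = s^{-1/2} ∑_{j < s} E_{(n+1, x + j s^n)}`. -/
def shiftVec {s : ℕ} (v : Vertex s) : Hil s :=
  ((1 / √(s : ℝ) : ℝ) : ℂ) • ∑ j : Fin s, basisVec (child v j)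

theorem orthonormal_shiftVec (s : ℕ) [NeZero s] :
    Orthonormal ℂ (shiftVec : Vertex s → Hil s) := by
  have hs : (s : ℂ) ≠ 0 := Nat.cast_ne_zero.mpr (NeZero.ne s)
  have hb : ∀ v w : Vertex s, inner ℂ (basisVec v) (basisVec w) = if v = w then (1 : ℂ) else 0 := by
    intro v w
    rw [basisVec, lp.inner_single_left, basisVec, lp.single_apply, Pi.single_apply]
    split_ifs <;> simp
  rw [orthonormal_iff_ite]
  intro v w
  have hc : ∀ i j : Fin s, inner ℂ (basisVec (child v i)) (basisVec (child w j)) =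
      if v = w ∧ i = j then (1 : ℂ) else 0 := by
    intro i j
    rw [hb]
    refine if_congr ⟨child_inj, ?_⟩ rfl rfl
    rintro ⟨rfl, rfl⟩
    rfl
  have hq : (((1 / √(s : ℝ) : ℝ) : ℂ)) * ((1 / √(s : ℝ) : ℝ) : ℂ) * s = 1 := by
    rw [← Complex.ofReal_mul, div_mul_div_comm, one_mul, Real.mul_self_sqrt (Nat.cast_nonneg s)]
    push_cast
    field_simp
  simp only [shiftVec, inner_smul_left, inner_smul_right, sum_inner, inner_sum, hc,
    Complex.conj_ofReal]
  by_cases hvw : v = w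
  · simp only [hvw, true_and, if_true]
    simp only [Finset.sum_ite_eq', Finset.mem_univ, if_true, Finset.sum_const,
      Finset.card_univ, Fintype.card_fin, nsmul_eq_mul, mul_one]
    rw [← hq]
    ring
  · simp [hvw]

/-- The Serre shift: the isometry `W` of `H` with
`W E_{(n,x)} = s^{-1/2} ∑_{j < s} E_{(n+1, x + j s^n)}`. -/
def W (s : ℕ) [NeZero s] : Hil s →L[ℂ] Hil s :=
  (orthonormal_shiftVec s).orthogonalFamily.linearIsometry.toContinuousLinearMap

theorem W_basisVec {s : ℕ} [NeZero s] (v : Vertex s) :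
    W s (basisVec v) = ((1 / √(s : ℝ) : ℝ) : ℂ) • ∑ j : Fin s, basisVec (child v j) := by
  simp [W, basisVec, shiftVec]

theorem diagOp_basisVec {s : ℕ} (F : lp (fun _ : Vertex s => ℂ) ∞) (v : Vertex s) :
    diagOp F (basisVec v) = F v • basisVec v := by
  ext w
  simp only [diagOp, basisVec, lp.mapCLM_apply_coe, lp.coeFn_smul, Pi.smul_apply]
  by_cases h : w = v
  · subst h; simp
  · simp [h]

/-! ### The algebras `A_W` and `B_W` -/

/-- The Serre shift algebra `A_W = C⋆(W, M_f : f ∈ C(ℤ_s))`. -/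
def algA (s : ℕ) [NeZero s] : StarSubalgebra ℂ (Hil s →L[ℂ] Hil s) :=
  (StarAlgebra.adjoin ℂ
    (insert (W s) (Set.range fun f : C(SAdic s, ℂ) => diagOp (pullback f)))).topologicalClosure

/-- The functions `F` on `𝒱` for which there is `f ∈ C(ℤ_s)` with
`lim_n sup_{0 ≤ x < s^n} |F(n,x) - f(x)| = 0`. -/
def funcF (s : ℕ) [NeZero s] : Set (Vertex s → ℂ) :=
  {F | ∃ f : C(SAdic s, ℂ), Filter.Tendsto
    (fun n : ℕ => ⨆ x : Fin (s ^ n), ‖F ⟨n, x⟩ - f (ofNat s x)‖) Filter.atTop (𝓝 0)}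

/-- The projections `𝒫_n = W^n (I - W W⋆) (W⋆)^n`. -/
def projP (s : ℕ) [NeZero s] (n : ℕ) : Hil s →L[ℂ] Hil s :=
  W s ^ n * (1 - W s * star (W s)) * star (W s) ^ n

/-- `B_W = C⋆(M_F, 𝒫_n : F ∈ 𝓕, n ≥ 0)`. (Every element of `𝓕` is a bounded function.) -/
def algB (s : ℕ) [NeZero s] : StarSubalgebra ℂ (Hil s →L[ℂ] Hil s) :=
  (StarAlgebra.adjoin ℂ
    ({T | ∃ F : lp (fun _ : Vertex s => ℂ) ∞, ⇑F ∈ funcF s ∧ T = diagOp F} ∪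
      Set.range (projP s))).topologicalClosure

instance (s : ℕ) [NeZero s] : IsClosed (algA s : Set (Hil s →L[ℂ] Hil s)) :=
  StarSubalgebra.isClosed_topologicalClosure _

instance (s : ℕ) [NeZero s] : IsClosed (algB s : Set (Hil s →L[ℂ] Hil s)) :=
  StarSubalgebra.isClosed_topologicalClosure _

theorem W_mem_algA (s : ℕ) [NeZero s] : W s ∈ algA s :=
  StarSubalgebra.le_topologicalClosure _ (StarAlgebra.subset_adjoin ℂ _ (Set.mem_insert _ _))

/-- The unitary `𝒰_θ E_{(n,x)} = e^{2πinθ} E_{(n,x)}`. -/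
def gaugeU (s : ℕ) (θ : ℝ) : Hil s →L[ℂ] Hil s :=
  diagOp ⟨fun v => Complex.exp (2 * Real.pi * Complex.I * v.1 * θ), memℓp_infty ⟨1, by
    rintro _ ⟨v, rfl⟩
    have : (2 * Real.pi * Complex.I * v.1 * θ : ℂ) =
        ((2 * Real.pi * v.1 * θ : ℝ) : ℂ) * Complex.I := by push_cast; ring
    simp only [this, Complex.norm_exp_ofReal_mul_I, le_refl]⟩⟩

/-- The gauge action `ρ_θ(a) = 𝒰_θ a 𝒰_θ⁻¹`, where `𝒰_θ⁻¹ = 𝒰_{-θ}`. -/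
def gauge (s : ℕ) (θ : ℝ) (a : Hil s →L[ℂ] Hil s) : Hil s →L[ℂ] Hil s :=
  gaugeU s θ * a * gaugeU s (-θ)

end SerreShift

end

noncomputable section

namespace SerreShift

open InnerProductSpace

/-! ### The canonical basis and diagonal operators -/

variable {s : ℕ}

/-! Two facts about the tree drive the proof. First, `W⋆ M_f W` is again diagonal: it averages `f`
over the children of a vertex. A suitable locally constant `f` makes this average differ from `f` at
one vertex only, so `A_W` contains every projection onto a basis vector (`rankOne_self_mem_algA`),
hence every diagonal operator vanishing at infinity, hence every `M_F` and all of `B_W`. Second, a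
vertex and its parent share all digits but the top one, so for `F` in `funcF` the operators `M_F`
and `M_{F ∘ parent}` differ by a compact operator. Thus `W⋆` commutes with `M_F` modulo matrix
units, and `A_W` is the closed span of the operators `M_F W^m (W⋆)^n` and the matrix units
(`algA_le_closure_span`).

These spanning elements are homogeneous for the gauge action. Averaging over roots of unity is
contractive and, for large order, keeps only the degree zero part of an element of the span; that
part lies in `B_W`. This identifies `B_W` with the gauge-invariant elements of `A_W`
(`mem_algB_iff`), and makes `B_W` stable under `b ↦ W b W⋆` and `b ↦ W⋆ b W`.

For the crossed product, `(B_W, W)` is itself a covariant representation, so it is one coordinate of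
the universal one, and the point is that this coordinate is isometric. Stability under `W⋆ · W`
makes the universal algebra graded with degree zero part `ι(B_W)`. The coordinate is isometric on
each degree by the C⋆-identity, and the gauge averages recover components contractively. This gives
a norm estimate with a factor linear in the number of degrees, which disappears on taking high
powers of self-adjoint elements (`norm_le_of_mem_filtration_of_isSelfAdjoint`). -/

theorem inner_basisVec_left (v : Vertex s) (x : Hil s) : inner ℂ (basisVec v) x = x v := by
  rw [basisVec, lp.inner_single_left]
  simp

theorem basisVec_apply (v w : Vertex s) : basisVec v w = if w = v then (1 : ℂ) else 0 := by
  rw [basisVec, lp.single_apply, Pi.single_apply]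

theorem norm_basisVec (v : Vertex s) : ‖basisVec v‖ = 1 := by
  rw [basisVec, lp.norm_single (by norm_num), norm_one]

theorem inner_basisVec_basisVec (v w : Vertex s) :
    inner ℂ (basisVec v) (basisVec w) = if v = w then (1 : ℂ) else 0 := by
  rw [inner_basisVec_left, basisVec_apply]

theorem hasSum_basisVec (x : Hil s) : HasSum (fun v => x v • basisVec v) x := by
  have h := lp.hasSum_single (by norm_num) x
  convert h using 2 with v
  rw [basisVec, ← lp.single_smul]
  simp

theorem closure_span_basisVec :
    (Submodule.span ℂ (Set.range (basisVec : Vertex s → Hil s))).topologicalClosure = ⊤ := by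
  rw [eq_top_iff]
  intro x _
  exact mem_closure_of_tendsto (hasSum_basisVec x) (Filter.Eventually.of_forall fun t =>
    Submodule.sum_mem _ fun v _ => Submodule.smul_mem _ _ (Submodule.subset_span ⟨v, rfl⟩))

theorem clm_ext_basisVec {E : Type*} [TopologicalSpace E] [AddCommMonoid E] [Module ℂ E] [T2Space E]
    {S T : Hil s →L[ℂ] E} (h : ∀ v, S (basisVec v) = T (basisVec v)) : S = T :=
  ContinuousLinearMap.ext_on (s := Set.range basisVec)
    (Submodule.dense_iff_topologicalClosure_eq_top.mpr closure_span_basisVec)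
    (by rintro _ ⟨v, rfl⟩; exact h v)

theorem hil_ext_inner {x y : Hil s} (h : ∀ v, inner ℂ (basisVec v) x = inner ℂ (basisVec v) y) :
    x = y := by
  ext v
  simpa only [inner_basisVec_left] using h v

theorem inner_star_basisVec (T : Hil s →L[ℂ] Hil s) (v : Vertex s) (x : Hil s) :
    inner ℂ (basisVec v) (star T x) = inner ℂ (T (basisVec v)) x := by
  rw [ContinuousLinearMap.star_eq_adjoint, ContinuousLinearMap.adjoint_inner_right]

theorem diagOp_mul (F G : lp (fun _ : Vertex s => ℂ) ∞) :
    diagOp (F * G) = diagOp F * diagOp G := by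
  refine clm_ext_basisVec fun v => ?_
  simp [diagOp_basisVec, lp.infty_coeFn_mul, smul_smul, mul_comm]

theorem diagOp_add (F G : lp (fun _ : Vertex s => ℂ) ∞) :
    diagOp (F + G) = diagOp F + diagOp G := by
  refine clm_ext_basisVec fun v => ?_
  simp [diagOp_basisVec, add_smul]

theorem diagOp_sub (F G : lp (fun _ : Vertex s => ℂ) ∞) :
    diagOp (F - G) = diagOp F - diagOp G := by
  refine clm_ext_basisVec fun v => ?_
  simp [diagOp_basisVec, sub_smul]

theorem diagOp_one : diagOp (1 : lp (fun _ : Vertex s => ℂ) ∞) = 1 := by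
  refine clm_ext_basisVec fun v => ?_
  simp [diagOp_basisVec]

theorem star_diagOp (F : lp (fun _ : Vertex s => ℂ) ∞) : star (diagOp F) = diagOp (star F) := by
  refine clm_ext_basisVec fun v => hil_ext_inner fun w => ?_
  rw [inner_star_basisVec, diagOp_basisVec, diagOp_basisVec, inner_smul_left, inner_smul_right,
    inner_basisVec_basisVec]
  by_cases h : w = v <;> simp [h]

theorem norm_diagOp_le (F : lp (fun _ : Vertex s => ℂ) ∞) : ‖diagOp F‖ ≤ ‖F‖ :=
  lp.norm_mapCLM_le _ _ _ _

/-! ### Functions vanishing at infinity -/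

/-- The filter of neighbourhoods of infinity in the set of vertices. -/
abbrev atInfty (s : ℕ) : Filter (Vertex s) := Filter.comap Sigma.fst Filter.atTop

theorem eventually_atInfty {p : Vertex s → Prop} :
    (∀ᶠ v in atInfty s, p v) ↔ ∃ N, ∀ v : Vertex s, N ≤ v.1 → p v := by
  rw [Filter.eventually_comap, Filter.eventually_atTop]
  exact ⟨fun ⟨N, h⟩ => ⟨N, fun v hv => h _ hv v rfl⟩,
    fun ⟨N, h⟩ => ⟨N, fun n hn v hv => h v (hv ▸ hn)⟩⟩

/-- A diagonal operator whose symbol vanishes at infinity is a norm limit of linear combinations of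
the projections onto the basis vectors. -/
theorem diagOp_mem_of_tendsto {S : Submodule ℂ (Hil s →L[ℂ] Hil s)}
    (hS : IsClosed (S : Set (Hil s →L[ℂ] Hil s)))
    (h1 : ∀ v, rankOne ℂ (basisVec v) (basisVec v) ∈ S) {G : lp (fun _ : Vertex s => ℂ) ∞}
    (hG : Filter.Tendsto G (atInfty s) (𝓝 0)) : diagOp G ∈ S := by
  rw [← SetLike.mem_coe, ← hS.closure_eq, Metric.mem_closure_iff]
  intro ε hε
  obtain ⟨N, hN⟩ := eventually_atInfty.mp (Metric.tendsto_nhds.mp hG (ε / 2) (half_pos hε))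
  -- Each level is finite, so cutting off at level `N` leaves a finite sum; the error is diagonal
  -- with symbol at most `ε / 2`.
  set t : Finset (Vertex s) := (Finset.range N).sigma fun n => Finset.univ with ht
  refine ⟨∑ v ∈ t, G v • rankOne ℂ (basisVec v) (basisVec v),
    S.sum_mem fun v _ => S.smul_mem _ (h1 v), ?_⟩
  have hK : ∀ v, ‖if v ∈ t then (0 : ℂ) else G v‖ ≤ ε / 2 := by
    intro v
    split_ifs with hv
    · simpa using (half_pos hε).le
    · have : N ≤ v.1 := by simpa [ht] using hv
      simpa using (hN v this).le
  let K : lp (fun _ : Vertex s => ℂ) ∞ :=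
    ⟨fun v => if v ∈ t then 0 else G v, memℓp_infty ⟨ε / 2, by rintro _ ⟨v, rfl⟩; exact hK v⟩⟩
  have hdiff : diagOp G - ∑ v ∈ t, G v • rankOne ℂ (basisVec v) (basisVec v) = diagOp K := by
    refine clm_ext_basisVec fun w => ?_
    simp only [sub_apply, sum_apply,
      smul_apply, rankOne_apply, inner_basisVec_basisVec, diagOp_basisVec]
    have hKw : K w = if w ∈ t then 0 else G w := rfl
    rw [hKw]
    by_cases hw : w ∈ t <;> simp [hw, Finset.sum_ite_eq', ite_smul]
  rw [dist_eq_norm, hdiff]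
  refine ((norm_diagOp_le K).trans (lp.norm_le_of_forall_le (half_pos hε).le hK)).trans_lt
    (half_lt_self hε)

/-! ### The Serre shift on the basis -/

/-- The vertex `(n, x mod s^n)` below `(n + 1, x)`; the root is its own parent. -/
def parent [NeZero s] : Vertex s → Vertex s
  | ⟨0, x⟩ => ⟨0, x⟩
  | ⟨n + 1, x⟩ => ⟨n, ⟨x % s ^ n, Nat.mod_lt _ (pow_pos (NeZero.pos s) n)⟩⟩

variable [NeZero s]

theorem parent_fst (v : Vertex s) : (parent v).1 = v.1 - 1 := by
  obtain ⟨_ | n, x⟩ := v <;> rfl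

theorem parent_child (v : Vertex s) (j : Fin s) : parent (child v j) = v := by
  obtain ⟨n, x⟩ := v
  simp [child, parent, Nat.mod_eq_of_lt x.isLt]

theorem exists_child_parent {v : Vertex s} (hv : v.1 ≠ 0) : ∃ j, v = child (parent v) j := by
  obtain ⟨_ | n, x⟩ := v
  · exact absurd rfl hv
  · have hs : 0 < s ^ n := pow_pos (NeZero.pos s) n
    refine ⟨⟨x / s ^ n, ?_⟩, ?_⟩
    · rw [Nat.div_lt_iff_lt_mul hs, ← pow_succ']
      exact x.isLt
    · simp only [child, parent]
      congr 1
      ext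
      simp [Nat.mod_add_div']

theorem W_isometry (s : ℕ) [NeZero s] : star (W s) * W s = 1 := by
  rw [ContinuousLinearMap.star_eq_adjoint]
  exact (ContinuousLinearMap.norm_map_iff_adjoint_comp_self _).mp
    fun x => LinearIsometry.norm_map _ x

theorem star_W_basisVec_child (v : Vertex s) (j : Fin s) :
    star (W s) (basisVec (child v j)) = ((1 / √(s : ℝ) : ℝ) : ℂ) • basisVec v := by
  refine hil_ext_inner fun w => ?_
  rw [inner_star_basisVec, W_basisVec, inner_smul_left, inner_smul_right, sum_inner,
    Complex.conj_ofReal]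
  congr 1
  simp only [inner_basisVec_basisVec]
  by_cases h : w = v
  · subst h
    rw [Finset.sum_eq_single j] <;> simp +contextual
    intro b hb h
    exact hb (child_inj h).2
  · rw [if_neg h, Finset.sum_eq_zero]
    intro i _
    rw [if_neg fun h' => h (child_inj h').1]

theorem star_W_basisVec {v : Vertex s} (hv : v.1 ≠ 0) :
    star (W s) (basisVec v) = ((1 / √(s : ℝ) : ℝ) : ℂ) • basisVec (parent v) := by
  obtain ⟨j, hj⟩ := exists_child_parent hv
  conv_lhs => rw [hj]
  exact star_W_basisVec_child _ _

/-- The function `F ∘ parent`. -/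
def shiftFun (F : lp (fun _ : Vertex s => ℂ) ∞) : lp (fun _ : Vertex s => ℂ) ∞ :=
  ⟨fun v => F (parent v), memℓp_infty ⟨‖F‖, by
    rintro _ ⟨v, rfl⟩
    exact lp.norm_apply_le_norm ENNReal.top_ne_zero F _⟩⟩

theorem shiftFun_apply (F : lp (fun _ : Vertex s => ℂ) ∞) (v : Vertex s) :
    shiftFun F v = F (parent v) := rfl

theorem W_mul_diagOp (F : lp (fun _ : Vertex s => ℂ) ∞) :
    W s * diagOp F = diagOp (shiftFun F) * W s := by
  refine clm_ext_basisVec fun v => ?_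
  simp only [mul_apply_eq_comp, diagOp_basisVec, map_smul, W_basisVec, map_sum,
    shiftFun_apply, parent_child, ← Finset.smul_sum]
  rw [smul_comm]

theorem star_W_mul_diagOp_shiftFun (F : lp (fun _ : Vertex s => ℂ) ∞) :
    star (W s) * diagOp (shiftFun F) = diagOp F * star (W s) := by
  have h := congrArg star (W_mul_diagOp (star F))
  rw [star_mul, star_mul, star_diagOp, star_diagOp, star_star] at h
  rw [h]
  congr 2
  ext v
  simp [shiftFun_apply]

/-! ### The functions in `funcF` -/

/-- Suprema over levels tending to zero amount to convergence along `atInfty`, a form in which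
limits can be added and composed with `parent`. -/
theorem mem_funcF_iff {F : Vertex s → ℂ} : F ∈ funcF s ↔ ∃ f : C(SAdic s, ℂ),
    Filter.Tendsto (fun v : Vertex s => F v - f (ofNat s v.2)) (atInfty s) (𝓝 0) := by
  refine exists_congr fun f => ?_
  rw [Metric.tendsto_nhds, Metric.tendsto_nhds]
  simp only [eventually_atInfty, Filter.eventually_atTop, dist_zero_right]
  have hb : ∀ n, BddAbove (Set.range fun x : Fin (s ^ n) => ‖F ⟨n, x⟩ - f (ofNat s x)‖) :=
    fun n => (Set.finite_range _).bddAbove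
  have h0 : ∀ n, 0 ≤ ⨆ x : Fin (s ^ n), ‖F ⟨n, x⟩ - f (ofNat s x)‖ :=
    fun n => Real.iSup_nonneg fun _ => norm_nonneg _
  constructor
  · intro h ε hε
    obtain ⟨N, hN⟩ := h ε hε
    refine ⟨N, fun ⟨n, x⟩ hv => ?_⟩
    have := hN n hv
    rw [Real.norm_of_nonneg (h0 n)] at this
    exact (le_ciSup (hb n) x).trans_lt this
  · intro h ε hε
    obtain ⟨N, hN⟩ := h (ε / 2) (half_pos hε)
    refine ⟨N, fun n hn => ?_⟩
    rw [Real.norm_of_nonneg (h0 n)]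
    refine lt_of_le_of_lt (Real.iSup_le (fun x => (hN ⟨n, x⟩ hn).le) (half_pos hε).le)
      (half_lt_self hε)

theorem ofNat_parent_apply {v : Vertex s} {j : ℕ} (hj : j + 1 < v.1) :
    ofNat s (parent v).2 j = ofNat s v.2 j := by
  obtain ⟨_ | n, x⟩ := v
  · exact absurd hj (by simp)
  · have hjn : j < n := by simpa using hj
    ext
    simp only [ofNat, parent, Fin.ofNat_eq_cast, Fin.val_natCast]
    obtain ⟨k, rfl⟩ : ∃ k, n = j + 1 + k := ⟨n - (j + 1), by omega⟩
    rw [show s ^ (j + 1 + k) = s ^ j * (s * s ^ k) by ring, Nat.mod_mul_right_div_self,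
      Nat.mod_mul_right_mod]

theorem tendsto_parent : Filter.Tendsto (parent : Vertex s → Vertex s) (atInfty s) (atInfty s) := by
  rw [Filter.tendsto_comap_iff]
  have : (Sigma.fst ∘ parent : Vertex s → ℕ) = (fun n => n - 1) ∘ Sigma.fst :=
    funext fun v => parent_fst v
  rw [this]
  exact (Filter.tendsto_sub_atTop_nat 1).comp Filter.tendsto_comap

/-- Passing to the parent erases only the top digit, whose position goes to infinity with the level,
and `f` is uniformly continuous by compactness. -/
theorem tendsto_ofNat_sub_parent (f : C(SAdic s, ℂ)) :
    Filter.Tendsto (fun v : Vertex s => f (ofNat s (parent v).2) - f (ofNat s v.2))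
      (atInfty s) (𝓝 0) := by
  let _ : MetricSpace (SAdic s) := PiNat.metricSpace
  have hu : UniformContinuous f := CompactSpace.uniformContinuous_of_continuous f.continuous
  rw [Metric.tendsto_nhds]
  intro ε hε
  obtain ⟨δ, hδ, h⟩ := Metric.uniformContinuous_iff.mp hu ε hε
  obtain ⟨N, hN⟩ := exists_pow_lt_of_lt_one hδ (by norm_num : (1 / 2 : ℝ) < 1)
  refine eventually_atInfty.mpr ⟨N + 1, fun v hv => ?_⟩
  rw [dist_zero_right, ← dist_eq_norm]
  refine h (lt_of_le_of_lt (PiNat.mem_cylinder_iff_dist_le.mp ?_) hN)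
  rw [PiNat.mem_cylinder_iff]
  intro i hi
  exact ofNat_parent_apply (by omega)

theorem pullback_mem_funcF (f : C(SAdic s, ℂ)) : ⇑(pullback f) ∈ funcF s :=
  mem_funcF_iff.mpr ⟨f, by simpa [pullback] using tendsto_const_nhds⟩

/-- This is the source of the commutation of `W⋆` with `M_F` modulo compact operators. -/
theorem shiftFun_sub_tendsto {F : lp (fun _ : Vertex s => ℂ) ∞} (hF : ⇑F ∈ funcF s) :
    Filter.Tendsto (F - shiftFun F : lp (fun _ : Vertex s => ℂ) ∞) (atInfty s) (𝓝 0) := by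
  obtain ⟨f, hf⟩ := mem_funcF_iff.mp hF
  have := (hf.sub (hf.comp tendsto_parent)).sub (tendsto_ofNat_sub_parent f)
  simp only [sub_zero] at this
  refine this.congr fun v => ?_
  simp only [lp.coeFn_sub, Pi.sub_apply, shiftFun_apply, Function.comp_apply]
  ring

theorem mem_funcF_of_tendsto_sub {F G : Vertex s → ℂ} (hF : F ∈ funcF s)
    (h : Filter.Tendsto (fun v => F v - G v) (atInfty s) (𝓝 0)) : G ∈ funcF s := by
  obtain ⟨f, hf⟩ := mem_funcF_iff.mp hF
  refine mem_funcF_iff.mpr ⟨f, ?_⟩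
  have := hf.sub h
  simp only [sub_zero] at this
  refine this.congr fun v => ?_
  ring

theorem shiftFun_mem_funcF {F : lp (fun _ : Vertex s => ℂ) ∞} (hF : ⇑F ∈ funcF s) :
    ⇑(shiftFun F) ∈ funcF s :=
  mem_funcF_of_tendsto_sub hF (shiftFun_sub_tendsto hF)

theorem pullback_mul_mem_funcF (f : C(SAdic s, ℂ)) {F : lp (fun _ : Vertex s => ℂ) ∞}
    (hF : ⇑F ∈ funcF s) : ⇑(pullback f * F) ∈ funcF s := by
  obtain ⟨g, hg⟩ := mem_funcF_iff.mp hF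
  refine mem_funcF_iff.mpr ⟨f * g, ?_⟩
  rw [tendsto_zero_iff_norm_tendsto_zero] at hg ⊢
  refine squeeze_zero (fun _ => norm_nonneg _) (fun v => ?_)
    (by simpa using hg.const_mul ‖f‖)
  have : (pullback f * F : lp (fun _ : Vertex s => ℂ) ∞) v - (f * g) (ofNat s v.2) =
      f (ofNat s v.2) * (F v - g (ofNat s v.2)) := by
    rw [lp.infty_coeFn_mul, Pi.mul_apply, ContinuousMap.mul_apply, mul_sub]
    rfl
  rw [this, norm_mul]
  gcongr
  exact f.norm_coe_le_norm _

theorem one_mem_funcF : ⇑(1 : lp (fun _ : Vertex s => ℂ) ∞) ∈ funcF s :=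
  mem_funcF_iff.mpr ⟨1, by simpa using tendsto_const_nhds⟩

end SerreShift

namespace SerreShift

open InnerProductSpace

variable {s : ℕ} [NeZero s]

/-! ### Digits of the vertices -/

theorem ofNat_apply_of_lt_pow {n x i : ℕ} (hx : x < s ^ n) (hi : n ≤ i) : ofNat s x i = 0 := by
  have : x / s ^ i = 0 :=
    Nat.div_eq_of_lt (hx.trans_le (Nat.pow_le_pow_right (NeZero.pos s) hi))
  simp [ofNat, this]

theorem ofNat_child (v : Vertex s) (j : Fin s) :
    ofNat s (child v j).2 = Function.update (ofNat s v.2) v.1 j := by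
  obtain ⟨n, x⟩ := v
  have hpos : ∀ k, 0 < s ^ k := fun k => pow_pos (NeZero.pos s) k
  funext i
  obtain hi | rfl | hi := lt_trichotomy i n
  · rw [Function.update_of_ne hi.ne]
    ext
    simp only [ofNat, child, Fin.ofNat_eq_cast, Fin.val_natCast]
    obtain ⟨k, rfl⟩ : ∃ k, n = i + 1 + k := ⟨n - (i + 1), by omega⟩
    rw [show (j : ℕ) * s ^ (i + 1 + k) = s ^ i * (s * (s ^ k * j)) by ring,
      Nat.add_mul_div_left _ _ (hpos i), Nat.add_mul_mod_self_left]
  · rw [Function.update_self]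
    ext
    simp only [ofNat, child, Fin.ofNat_eq_cast, Fin.val_natCast]
    rw [Nat.add_mul_div_right _ _ (hpos i), Nat.div_eq_of_lt x.isLt, zero_add,
      Nat.mod_eq_of_lt j.isLt]
  · rw [Function.update_of_ne hi.ne']
    rw [ofNat_apply_of_lt_pow x.isLt hi.le, ofNat_apply_of_lt_pow (child ⟨n, x⟩ j).2.isLt hi]

theorem mod_pow_eq_of_ofNat_eq {x y M : ℕ} (h : ∀ i < M, ofNat s x i = ofNat s y i) :
    x % s ^ M = y % s ^ M := by
  induction M with
  | zero => simp [Nat.mod_one]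
  | succ M ih =>
    have hM := congrArg Fin.val (h M (Nat.lt_succ_self M))
    simp only [ofNat, Fin.ofNat_eq_cast, Fin.val_natCast] at hM
    rw [Nat.mod_pow_succ, Nat.mod_pow_succ, ih fun i hi => h i (hi.trans (Nat.lt_succ_self M)), hM]

/-- The `s`-adic integers whose first `n` digits are those of `v = (n, x)` and whose next digit is
not zero. -/
def branchSet (v : Vertex s) : Set (SAdic s) :=
  (⋂ i ∈ Finset.range v.1, (fun z : SAdic s => z i) ⁻¹' {ofNat s v.2 i}) ∩
    (fun z : SAdic s => z v.1) ⁻¹' {0}ᶜ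

theorem mem_branchSet {v : Vertex s} {z : SAdic s} :
    z ∈ branchSet v ↔ (∀ i < v.1, z i = ofNat s v.2 i) ∧ z v.1 ≠ 0 := by
  simp [branchSet]

theorem isClopen_branchSet (v : Vertex s) : IsClopen (branchSet v) :=
  (isClopen_biInter_finset fun i _ => (isClopen_discrete _).preimage (continuous_apply i)).inter
    ((isClopen_discrete _).preimage (continuous_apply _))

/-- The characteristic function of `branchSet v`. -/
def branchFun (v : Vertex s) : C(SAdic s, ℂ) :=
  (LocallyConstant.charFn ℂ (isClopen_branchSet v) : C(SAdic s, ℂ))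

open Classical in
theorem branchFun_apply (v : Vertex s) (z : SAdic s) :
    branchFun v z = if z ∈ branchSet v then 1 else 0 := by
  simp [branchFun, LocallyConstant.coe_charFn, Set.indicator_apply]

theorem star_W_diagOp_W_basisVec (F : lp (fun _ : Vertex s => ℂ) ∞) (w : Vertex s) :
    (star (W s) * diagOp F * W s) (basisVec w) =
      ((s : ℂ)⁻¹ * ∑ j, F (child w j)) • basisVec w := by
  have hq : (((1 / √(s : ℝ) : ℝ) : ℂ)) * ((1 / √(s : ℝ) : ℝ) : ℂ) = (s : ℂ)⁻¹ := by
    rw [← Complex.ofReal_mul, div_mul_div_comm, one_mul, Real.mul_self_sqrt (Nat.cast_nonneg s)]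
    push_cast
    rw [one_div]
  simp only [mul_apply_eq_comp, W_basisVec, map_smul, map_sum, diagOp_basisVec,
    star_W_basisVec_child, ← hq, mul_smul, Finset.sum_smul, Finset.smul_sum]
  refine Finset.sum_congr rfl fun j _ => ?_
  rw [smul_comm (F (child w j))]

/-- The function tests the digits of index at most `v.1`, and a child of `w` differs from `w` only
in digit `w.1`. Below the level of `v`, digit `v.1` is zero for `w` and its children, so everything
vanishes. Above it, the tested digits are inherited and the mean equals the value. At the level of
`v` the value is zero, and if `w = v` exactly `s - 1` of the `s` children have a nonzero new digit.
-/
theorem sum_branchFun_child (v w : Vertex s) :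
    (s : ℂ)⁻¹ * ∑ j, branchFun v (ofNat s (child w j).2) - branchFun v (ofNat s w.2) =
      if w = v then 1 - (s : ℂ)⁻¹ else 0 := by
  classical
  have hs : (s : ℂ) ≠ 0 := Nat.cast_ne_zero.mpr (NeZero.ne s)
  simp only [branchFun_apply, ofNat_child, mem_branchSet]
  obtain h | h | h := lt_trichotomy w.1 v.1
  · have h0 : ofNat s (w.2 : ℕ) v.1 = 0 := ofNat_apply_of_lt_pow w.2.isLt h.le
    have hne : w ≠ v := fun e => h.ne (congrArg Sigma.fst e)
    simp [Function.update_of_ne h.ne', h0, hne]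
  · obtain ⟨n, x⟩ := w
    obtain ⟨m, y⟩ := v
    obtain rfl : n = m := h
    have h0 : ofNat s (x : ℕ) n = 0 := ofNat_apply_of_lt_pow x.isLt le_rfl
    have hiff : (∀ i < n, ofNat s (x : ℕ) i = ofNat s (y : ℕ) i) ↔ x = y := by
      refine ⟨fun hd => Fin.ext ?_, fun e _ _ => by rw [e]⟩
      simpa [Nat.mod_eq_of_lt x.isLt, Nat.mod_eq_of_lt y.isLt] using mod_pow_eq_of_ofNat_eq hd
    have hup : ∀ j : Fin s, (∀ i < n, Function.update (ofNat s (x : ℕ)) n j i = ofNat s (y : ℕ) i)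
        ↔ x = y := fun j => by
      rw [← hiff]
      exact forall₂_congr fun i hi => by rw [Function.update_of_ne hi.ne]
    simp only [hup, hiff, h0, Function.update_self]
    by_cases hxy : x = y
    · subst hxy
      have : ∑ j : Fin s, (if j ≠ 0 then (1 : ℂ) else 0) = s - 1 := by
        rw [Finset.sum_ite]
        simp [Finset.filter_ne', Finset.card_erase_of_mem, Nat.cast_sub (NeZero.one_le (n := s))]
      simp only [true_and, this]
      simp
      field_simp
    · simp [hxy]
  · have hne : w ≠ v := fun e => h.ne' (congrArg Sigma.fst e)
    have hup : ∀ (j : Fin s), ((∀ i < v.1, Function.update (ofNat s (w.2 : ℕ)) w.1 j i =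
        ofNat s (v.2 : ℕ) i) ∧ Function.update (ofNat s (w.2 : ℕ)) w.1 j v.1 ≠ 0) ↔
        ((∀ i < v.1, ofNat s (w.2 : ℕ) i = ofNat s (v.2 : ℕ) i) ∧ ofNat s (w.2 : ℕ) v.1 ≠ 0) := by
      intro j
      rw [Function.update_of_ne h.ne]
      exact and_congr_left fun _ => forall₂_congr fun i hi => by
        rw [Function.update_of_ne (hi.trans h).ne]
    simp only [hup, hne, Finset.sum_const, Finset.card_univ, Fintype.card_fin, nsmul_eq_mul,
      if_false]
    field_simp
    ring

/-! ### `B_W` is contained in `A_W` -/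

theorem diagOp_pullback_mem_algA (f : C(SAdic s, ℂ)) : diagOp (pullback f) ∈ algA s :=
  StarSubalgebra.le_topologicalClosure _
    (StarAlgebra.subset_adjoin ℂ _ (Set.mem_insert_of_mem _ ⟨f, rfl⟩))

/-- The projection is a multiple of `W⋆ M_f W - M_f` with `f = branchFun v`. The scalar `1 - 1/s`
can be inverted because `s ≥ 2`. -/
theorem rankOne_self_mem_algA (hs : 2 ≤ s) (v : Vertex s) :
    rankOne ℂ (basisVec v) (basisVec v) ∈ algA s := by
  have hc : (1 - (s : ℂ)⁻¹) ≠ 0 := by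
    rw [sub_ne_zero]
    intro h
    have : (s : ℂ) = 1 := by rw [← inv_inv (s : ℂ), ← h, inv_one]
    have : s = 1 := by exact_mod_cast this
    omega
  have key : (1 - (s : ℂ)⁻¹) • rankOne ℂ (basisVec v) (basisVec v) =
      star (W s) * diagOp (pullback (branchFun v)) * W s - diagOp (pullback (branchFun v)) := by
    refine clm_ext_basisVec fun w => ?_
    rw [sub_apply, star_W_diagOp_W_basisVec, diagOp_basisVec, ← sub_smul, smul_apply, rankOne_apply,
      inner_basisVec_basisVec]
    have := sum_branchFun_child v w
    simp only [pullback]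
    rw [this]
    by_cases h : w = v
    · simp [h]
    · simp [h, Ne.symm h]
  rw [← inv_smul_smul₀ hc (rankOne ℂ (basisVec v) (basisVec v)), key]
  have hF := diagOp_pullback_mem_algA (branchFun v)
  exact SMulMemClass.smul_mem _ (sub_mem (mul_mem (mul_mem (star_mem (W_mem_algA s)) hF)
    (W_mem_algA s)) hF)

theorem diagOp_mem_algA (hs : 2 ≤ s) {F : lp (fun _ : Vertex s => ℂ) ∞} (hF : ⇑F ∈ funcF s) :
    diagOp F ∈ algA s := by
  obtain ⟨f, hf⟩ := mem_funcF_iff.mp hF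
  have h1 : diagOp (F - pullback f) ∈ (algA s).toSubalgebra.toSubmodule :=
    diagOp_mem_of_tendsto (inferInstance : IsClosed (algA s : Set (Hil s →L[ℂ] Hil s)))
      (rankOne_self_mem_algA hs) hf
  have h2 := add_mem (show diagOp (F - pullback f) ∈ algA s from h1) (diagOp_pullback_mem_algA f)
  rwa [← diagOp_add, sub_add_cancel] at h2

theorem algB_le_algA (hs : 2 ≤ s) : algB s ≤ algA s := by
  refine StarSubalgebra.topologicalClosure_minimal (StarAlgebra.adjoin_le ?_)
    (inferInstance : IsClosed (algA s : Set (Hil s →L[ℂ] Hil s)))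
  have hW := W_mem_algA s
  rintro _ (⟨F, hF, rfl⟩ | ⟨n, rfl⟩)
  · exact diagOp_mem_algA hs hF
  · exact mul_mem (mul_mem (pow_mem hW n) (sub_mem (one_mem _) (mul_mem hW (star_mem hW))))
      (pow_mem (star_mem hW) n)

/-! ### Elements of `B_W` -/

theorem diagOp_mem_algB {F : lp (fun _ : Vertex s => ℂ) ∞} (hF : ⇑F ∈ funcF s) :
    diagOp F ∈ algB s :=
  StarSubalgebra.le_topologicalClosure _
    (StarAlgebra.subset_adjoin ℂ _ (Or.inl ⟨F, hF, rfl⟩))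

/-- Telescoping: `𝒫_n` is the difference of the range projections of `W^n` and `W^(n+1)`. -/
theorem W_pow_mul_star_W_pow_mem_algB (n : ℕ) : W s ^ n * star (W s) ^ n ∈ algB s := by
  induction n with
  | zero => simp
  | succ n ih =>
    have h : projP s n ∈ algB s := StarSubalgebra.le_topologicalClosure _
      (StarAlgebra.subset_adjoin ℂ _ (Or.inr ⟨n, rfl⟩))
    have := sub_mem ih h
    convert this using 1
    rw [projP, pow_succ, pow_succ']
    noncomm_ring

theorem star_W_pow_basisVec (v : Vertex s) :
    (star (W s) ^ v.1) (basisVec v) =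
      ((1 / √(s : ℝ) : ℝ) : ℂ) ^ v.1 • basisVec ⟨0, ⟨0, by simp⟩⟩ := by
  obtain ⟨n, x⟩ := v
  induction n with
  | zero =>
    simp only [pow_zero, one_smul]
    show basisVec _ = _
    congr
    ext
    have := x.isLt
    simp at this
    simpa using this
  | succ n ih =>
    simp only [pow_succ, mul_apply_eq_comp]
    rw [star_W_basisVec (Nat.succ_ne_zero n), map_smul]
    have := ih (parent ⟨n + 1, x⟩).2
    rw [mul_comm, mul_smul]
    exact congrArg _ this

/-- At level `n`, `(W⋆)^n` sends every basis vector to the same multiple of the root vector. So `W^n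
(W⋆)^n` has the nonzero entry `s^(-n)` between any two vertices of that level, and cutting it down
by two diagonal projections isolates the matrix unit. -/
theorem rankOne_mem_algB {v w : Vertex s} (h : v.1 = w.1) :
    rankOne ℂ (basisVec v) (basisVec w) ∈ algB s := by
  have hself : ∀ v : Vertex s, rankOne ℂ (basisVec v) (basisVec v) ∈ algB s := by
    intro v
    have : rankOne ℂ (basisVec v) (basisVec v) = diagOp (lp.single ∞ v 1) := by
      refine clm_ext_basisVec fun w => ?_
      rw [diagOp_basisVec, rankOne_apply, inner_basisVec_basisVec, lp.single_apply, Pi.single_apply]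
      by_cases h : w = v
      · simp [h]
      · simp [h, Ne.symm h]
    rw [this]
    -- A symbol supported at one vertex vanishes on all higher levels, so its limit function is `0`.
    refine diagOp_mem_algB (mem_funcF_iff.mpr ⟨0, ?_⟩)
    refine tendsto_const_nhds.congr' ?_
    refine eventually_atInfty.mpr ⟨v.1 + 1, fun w hw => ?_⟩
    have : w ≠ v := fun e => by subst e; omega
    simp [lp.single_apply, this]
  have hc : (((1 / √(s : ℝ) : ℝ) : ℂ) ^ v.1 * ((1 / √(s : ℝ) : ℝ) : ℂ) ^ v.1) ≠ 0 := by
    have : (0 : ℝ) < s := Nat.cast_pos.mpr (NeZero.pos s)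
    have h' : ((1 / √(s : ℝ) : ℝ) : ℂ) ≠ 0 := Complex.ofReal_ne_zero.mpr (by positivity)
    exact mul_ne_zero (pow_ne_zero _ h') (pow_ne_zero _ h')
  have key : (((1 / √(s : ℝ) : ℝ) : ℂ) ^ v.1 * ((1 / √(s : ℝ) : ℝ) : ℂ) ^ v.1) •
      rankOne ℂ (basisVec v) (basisVec w) =
      rankOne ℂ (basisVec v) (basisVec v) * (W s ^ v.1 * star (W s) ^ v.1) *
        rankOne ℂ (basisVec w) (basisVec w) := by
    have hi : inner ℂ (basisVec v) ((W s ^ v.1 * star (W s) ^ v.1) (basisVec w)) =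
        (((1 / √(s : ℝ) : ℝ) : ℂ) ^ v.1 * ((1 / √(s : ℝ) : ℝ) : ℂ) ^ v.1) := by
      have h1 : W s ^ v.1 = star (star (W s) ^ v.1) := by rw [star_pow, star_star]
      rw [mul_apply_eq_comp, h1, inner_star_basisVec, star_W_pow_basisVec v]
      have h2 := star_W_pow_basisVec w
      rw [← h] at h2
      rw [h2, inner_smul_left, inner_smul_right, inner_basisVec_basisVec, if_pos rfl, mul_one,
        map_pow, Complex.conj_ofReal]
    ext1 x
    simp only [mul_apply_eq_comp, smul_apply, rankOne_apply, map_smul]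
    rw [← mul_apply_eq_comp, hi, smul_smul, smul_smul, mul_comm]
  rw [← inv_smul_smul₀ hc (rankOne ℂ (basisVec v) (basisVec w)), key]
  exact SMulMemClass.smul_mem _ (mul_mem (mul_mem (hself v)
    (W_pow_mul_star_W_pow_mem_algB v.1)) (hself w))

end SerreShift

namespace SerreShift

open InnerProductSpace

variable {s : ℕ}

/-! ### Homogeneous operators and averages over the gauge action -/

/-- `gauge s θ` as a continuous linear map. -/
def gaugeCLM (s : ℕ) (θ : ℝ) : (Hil s →L[ℂ] Hil s) →L[ℂ] (Hil s →L[ℂ] Hil s) :=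
  ContinuousLinearMap.mulLeftRight ℂ (Hil s →L[ℂ] Hil s) (gaugeU s θ) (gaugeU s (-θ))

theorem gaugeCLM_apply (θ : ℝ) (a : Hil s →L[ℂ] Hil s) : gaugeCLM s θ a = gauge s θ a := by
  simp [gaugeCLM, gauge]

/-- The character `θ ↦ e^{2πidθ}`. -/
def gaugeChar (d : ℤ) (θ : ℝ) : ℂ := Complex.exp (2 * Real.pi * Complex.I * d * θ)

theorem gaugeChar_zero (θ : ℝ) : gaugeChar 0 θ = 1 := by simp [gaugeChar]

theorem gaugeChar_add (d e : ℤ) (θ : ℝ) :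
    gaugeChar (d + e) θ = gaugeChar d θ * gaugeChar e θ := by
  rw [gaugeChar, gaugeChar, gaugeChar, ← Complex.exp_add]
  push_cast
  ring_nf

theorem gaugeChar_neg_right (d : ℤ) (θ : ℝ) : gaugeChar d (-θ) = gaugeChar (-d) θ := by
  simp [gaugeChar]

theorem gaugeChar_eq (d : ℤ) (θ : ℝ) :
    gaugeChar d θ = Complex.exp ((2 * Real.pi * d * θ : ℝ) * Complex.I) := by
  rw [gaugeChar]
  congr 1
  push_cast
  ring

theorem norm_gaugeChar (d : ℤ) (θ : ℝ) : ‖gaugeChar d θ‖ = 1 := by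
  rw [gaugeChar_eq, Complex.norm_exp_ofReal_mul_I]

theorem conj_gaugeChar (d : ℤ) (θ : ℝ) :
    (starRingEnd ℂ) (gaugeChar d θ) = gaugeChar (-d) θ := by
  rw [gaugeChar_eq, gaugeChar_eq, ← Complex.exp_conj]
  rw [map_mul, Complex.conj_I, Complex.conj_ofReal]
  congr 1
  push_cast
  ring

theorem gaugeU_basisVec (θ : ℝ) (v : Vertex s) :
    gaugeU s θ (basisVec v) = gaugeChar v.1 θ • basisVec v := by
  rw [gaugeU, diagOp_basisVec]
  simp [gaugeChar]

theorem star_gaugeU (θ : ℝ) : star (gaugeU s θ) = gaugeU s (-θ) := by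
  refine clm_ext_basisVec fun v => hil_ext_inner fun w => ?_
  rw [inner_star_basisVec, gaugeU_basisVec, gaugeU_basisVec, inner_smul_left, inner_smul_right,
    inner_basisVec_basisVec, conj_gaugeChar, gaugeChar_neg_right]
  by_cases h : w = v <;> simp [h]

theorem gaugeU_neg_mul_gaugeU (θ : ℝ) : gaugeU s (-θ) * gaugeU s θ = 1 := by
  refine clm_ext_basisVec fun v => ?_
  rw [mul_apply_eq_comp, gaugeU_basisVec, map_smul, gaugeU_basisVec, smul_smul,
    gaugeChar_neg_right, ← gaugeChar_add, add_neg_cancel, gaugeChar_zero, one_smul]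
  rfl

theorem norm_gaugeU_le (θ : ℝ) : ‖gaugeU s θ‖ ≤ 1 := by
  refine (norm_diagOp_le _).trans (lp.norm_le_of_forall_le zero_le_one fun v => ?_)
  have := norm_gaugeChar v.1 θ
  simp only [gaugeChar, Int.cast_natCast] at this
  exact this.le

theorem norm_gauge_le (θ : ℝ) (a : Hil s →L[ℂ] Hil s) : ‖gauge s θ a‖ ≤ ‖a‖ := by
  rw [gauge]
  calc ‖gaugeU s θ * a * gaugeU s (-θ)‖ ≤ ‖gaugeU s θ‖ * ‖a‖ * ‖gaugeU s (-θ)‖ :=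
        (norm_mul_le _ _).trans (by gcongr; exact norm_mul_le _ _)
    _ ≤ 1 * ‖a‖ * 1 := by gcongr <;> exact norm_gaugeU_le _
    _ = ‖a‖ := by ring

theorem gauge_mul (θ : ℝ) (a b : Hil s →L[ℂ] Hil s) :
    gauge s θ (a * b) = gauge s θ a * gauge s θ b := by
  simp only [gauge]
  calc gaugeU s θ * (a * b) * gaugeU s (-θ) = gaugeU s θ * a * 1 * b * gaugeU s (-θ) := by
        noncomm_ring
    _ = _ := by
        rw [← gaugeU_neg_mul_gaugeU θ]
        noncomm_ring

theorem gauge_star (θ : ℝ) (a : Hil s →L[ℂ] Hil s) : gauge s θ (star a) = star (gauge s θ a) := by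
  simp only [gauge, star_mul, star_gaugeU, neg_neg, mul_assoc]

/-- The operator `a` is homogeneous of degree `d` for the gauge action. -/
def IsHomogeneous (a : Hil s →L[ℂ] Hil s) (d : ℤ) : Prop :=
  ∀ θ : ℝ, gauge s θ a = gaugeChar d θ • a

theorem isHomogeneous_zero_iff {a : Hil s →L[ℂ] Hil s} :
    IsHomogeneous a 0 ↔ ∀ θ : ℝ, gauge s θ a = a := by
  simp [IsHomogeneous, gaugeChar_zero]

theorem IsHomogeneous.mul {a b : Hil s →L[ℂ] Hil s} {d e : ℤ} (ha : IsHomogeneous a d)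
    (hb : IsHomogeneous b e) : IsHomogeneous (a * b) (d + e) := fun θ => by
  rw [gauge_mul, ha, hb, smul_mul_smul_comm, gaugeChar_add]

theorem IsHomogeneous.star {a : Hil s →L[ℂ] Hil s} {d : ℤ} (ha : IsHomogeneous a d) :
    IsHomogeneous (star a) (-d) := fun θ => by
  rw [gauge_star, ha, star_smul, ← conj_gaugeChar]
  rfl

theorem isHomogeneous_one : IsHomogeneous (1 : Hil s →L[ℂ] Hil s) 0 := fun θ => by
  have := gaugeU_neg_mul_gaugeU (s := s) (-θ)
  rw [neg_neg] at this
  rw [gauge, mul_one, this, gaugeChar_zero, one_smul]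

theorem IsHomogeneous.pow {a : Hil s →L[ℂ] Hil s} {d : ℤ} (ha : IsHomogeneous a d) (n : ℕ) :
    IsHomogeneous (a ^ n) (n * d) := by
  induction n with
  | zero => simpa using isHomogeneous_one
  | succ n ih =>
    rw [pow_succ]
    convert ih.mul ha using 1
    push_cast
    ring

theorem isHomogeneous_of_mul {a : Hil s →L[ℂ] Hil s} {d : ℤ}
    (h : ∀ θ : ℝ, gaugeU s θ * a = gaugeChar d θ • (a * gaugeU s θ)) : IsHomogeneous a d := by
  intro θ
  have := gaugeU_neg_mul_gaugeU (s := s) (-θ)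
  rw [neg_neg] at this
  rw [gauge, h, smul_mul_assoc, mul_assoc, this, mul_one]

theorem isHomogeneous_diagOp (F : lp (fun _ : Vertex s => ℂ) ∞) : IsHomogeneous (diagOp F) 0 := by
  refine isHomogeneous_of_mul fun θ => ?_
  rw [gaugeChar_zero, one_smul, gaugeU, ← diagOp_mul, ← diagOp_mul, mul_comm]

theorem isHomogeneous_rankOne (v w : Vertex s) :
    IsHomogeneous (rankOne ℂ (basisVec v) (basisVec w)) ((v.1 : ℤ) - w.1) := by
  refine isHomogeneous_of_mul fun θ => clm_ext_basisVec fun x => ?_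
  simp only [mul_apply_eq_comp, smul_apply, gaugeU_basisVec, rankOne_apply, map_smul,
    inner_basisVec_basisVec]
  by_cases h : w = x
  · simp only [h, if_true, one_smul, one_mul, smul_smul, ← gaugeChar_add, sub_add_cancel]
  · simp [h]

theorem isHomogeneous_W (s : ℕ) [NeZero s] : IsHomogeneous (W s) 1 := by
  refine isHomogeneous_of_mul fun θ => clm_ext_basisVec fun v => ?_
  simp only [mul_apply_eq_comp, smul_apply, gaugeU_basisVec, W_basisVec, map_smul, map_sum,
    child, smul_smul, Finset.smul_sum]
  refine Finset.sum_congr rfl fun j _ => ?_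
  congr 1
  push_cast
  rw [mul_comm, ← mul_assoc, ← gaugeChar_add, add_comm]

/-- The average of `e^{-2πikθ} ρ_θ` over the `N`-th roots of unity. -/
def gaugeAvg (s : ℕ) (k : ℤ) (N : ℕ) : (Hil s →L[ℂ] Hil s) →L[ℂ] (Hil s →L[ℂ] Hil s) :=
  (N : ℂ)⁻¹ • ∑ j ∈ Finset.range N, gaugeChar (-k) (j / N) • gaugeCLM s (j / N)

theorem gaugeAvg_apply (k : ℤ) (N : ℕ) (a : Hil s →L[ℂ] Hil s) : gaugeAvg s k N a =
    (N : ℂ)⁻¹ • ∑ j ∈ Finset.range N, gaugeChar (-k) (j / N) • gauge s (j / N) a := by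
  simp only [gaugeAvg, smul_apply, sum_apply, gaugeCLM_apply]

theorem norm_gaugeAvg_le (k : ℤ) (N : ℕ) (a : Hil s →L[ℂ] Hil s) : ‖gaugeAvg s k N a‖ ≤ ‖a‖ := by
  rw [gaugeAvg_apply, norm_smul, norm_inv, Complex.norm_natCast]
  have : ‖∑ j ∈ Finset.range N, gaugeChar (-k) (j / N) • gauge s (j / N) a‖ ≤ N * ‖a‖ := by
    refine (norm_sum_le_of_le _ fun j _ => (?_ : _ ≤ ‖a‖)).trans_eq (by simp)
    rw [norm_smul, norm_gaugeChar, one_mul]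
    exact norm_gauge_le _ _
  rcases Nat.eq_zero_or_pos N with rfl | hN
  · simp
  · rw [inv_mul_le_iff₀ (Nat.cast_pos.mpr hN)]
    exact this

/-- The coefficient is a geometric sum over powers of `e^{2πi(d-k)/N}`, which vanishes unless `N`
divides `d - k`; the size bound then leaves only `d = k`. Such finite averages take the place of
integration over the circle. -/
theorem gaugeAvg_of_isHomogeneous {a : Hil s →L[ℂ] Hil s} {d k : ℤ} {N : ℕ}
    (ha : IsHomogeneous a d) (hN : |d - k| < N) :
    gaugeAvg s k N a = if d = k then a else 0 := by
  have hN0 : (N : ℂ) ≠ 0 := by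
    rw [Nat.cast_ne_zero]
    rintro rfl
    exact absurd hN (not_lt.mpr (by simp))
  have hpow : ∀ j : ℕ, gaugeChar (d - k) (j / N) = gaugeChar (d - k) (1 / N) ^ j := by
    intro j
    rw [gaugeChar, gaugeChar, ← Complex.exp_nat_mul]
    congr 1
    push_cast
    ring
  have h1 : gaugeAvg s k N a =
      ((N : ℂ)⁻¹ * ∑ j ∈ Finset.range N, gaugeChar (d - k) (1 / N) ^ j) • a := by
    rw [gaugeAvg_apply, mul_smul, Finset.sum_smul]
    congr 1
    refine Finset.sum_congr rfl fun j _ => ?_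
    rw [ha, smul_smul, ← gaugeChar_add, ← hpow, neg_add_eq_sub]
  rw [h1]
  split_ifs with h
  · simp [h, gaugeChar_zero, hN0]
  · have hne : gaugeChar (d - k) (1 / N) ≠ 1 := by
      intro he
      obtain ⟨n, hn⟩ := Complex.exp_eq_one_iff.mp he
      have h2 : ((d - k : ℤ) : ℂ) = n * N := by
        have : (2 * Real.pi * Complex.I : ℂ) ≠ 0 := Complex.two_pi_I_ne_zero
        have h3 : (2 * Real.pi * Complex.I : ℂ) * ((d - k : ℤ) : ℂ) =
            (2 * Real.pi * Complex.I : ℂ) * (n * N) := by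
          rw [mul_left_comm, ← mul_assoc (n : ℂ), ← hn]
          push_cast
          field_simp
        exact mul_left_cancel₀ this h3
      have h4 : d - k = n * N := by exact_mod_cast h2
      rw [h4, abs_mul, Nat.abs_cast] at hN
      have : n ≠ 0 := by
        rintro rfl
        exact h (by linarith)
      have : 1 ≤ |n| := Int.one_le_abs this
      nlinarith [Int.natCast_nonneg N]
    have hone : gaugeChar (d - k) (1 / N) ^ N = 1 := by
      rw [← hpow, gaugeChar]
      refine Complex.exp_eq_one_iff.mpr ⟨d - k, ?_⟩
      push_cast
      field_simp
    rw [geom_sum_eq hne, hone]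
    simp

/-! ### A spanning set of `A_W` -/

/-- A continuous linear map which maps a set `t` into a closed submodule maps the closed span of
`t` into it. -/
theorem map_mem_of_forall_mem {E : Type*} [NormedAddCommGroup E] [NormedSpace ℂ E]
    (L : E →L[ℂ] E) {t : Set E} {S : Submodule ℂ E} (hS : IsClosed (S : Set E))
    (h : ∀ x ∈ t, L x ∈ S) {x : E} (hx : x ∈ (Submodule.span ℂ t).topologicalClosure) : L x ∈ S :=
  (Submodule.span ℂ t).topologicalClosure_minimal
    (t := S.comap (L : E →ₗ[ℂ] E)) (Submodule.span_le.mpr h) (hS.preimage L.continuous) hx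

/-- The closed span of the matrix units. -/
def compactOps (s : ℕ) : Submodule ℂ (Hil s →L[ℂ] Hil s) :=
  (Submodule.span ℂ (Set.range fun p : Vertex s × Vertex s =>
    rankOne ℂ (basisVec p.1) (basisVec p.2))).topologicalClosure

theorem isClosed_compactOps : IsClosed (compactOps s : Set (Hil s →L[ℂ] Hil s)) :=
  Submodule.isClosed_topologicalClosure _

theorem rankOne_basisVec_mem_compactOps (v w : Vertex s) :
    rankOne ℂ (basisVec v) (basisVec w) ∈ compactOps s :=
  Submodule.le_topologicalClosure _ (Submodule.subset_span ⟨(v, w), rfl⟩)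

theorem rankOne_mem_compactOps_left (x : Hil s) (w : Vertex s) :
    rankOne ℂ x (basisVec w) ∈ compactOps s := by
  have h : HasSum (fun v => rankOne ℂ (x v • basisVec v) (basisVec w)) (rankOne ℂ x (basisVec w)) :=
    (hasSum_basisVec x).mapL ((rankOne ℂ (E := Hil s) (F := Hil s)).flip (basisVec w))
  refine isClosed_compactOps.mem_of_tendsto h (Filter.Eventually.of_forall fun t =>
    Submodule.sum_mem _ fun v _ => ?_)
  rw [map_smul, smul_apply]
  exact Submodule.smul_mem _ _ (rankOne_basisVec_mem_compactOps v w)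

/-- Multiplying a matrix unit on the left changes only its first vector, which is expanded in the
basis. -/
theorem mul_mem_compactOps_left (a : Hil s →L[ℂ] Hil s) {k : Hil s →L[ℂ] Hil s}
    (hk : k ∈ compactOps s) : a * k ∈ compactOps s := by
  refine map_mem_of_forall_mem (ContinuousLinearMap.mul ℂ _ a) isClosed_compactOps ?_ hk
  rintro _ ⟨⟨v, w⟩, rfl⟩
  show a * _ ∈ _
  rw [ContinuousLinearMap.mul_def, comp_rankOne]
  exact rankOne_mem_compactOps_left _ _

theorem rankOne_mem_compactOps_right (v : Vertex s) (x : Hil s) :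
    rankOne ℂ (basisVec v) x ∈ compactOps s := by
  have h : HasSum (fun w => rankOne ℂ (basisVec v) (x w • basisVec w)) (rankOne ℂ (basisVec v) x) :=
    (hasSum_basisVec x).mapL (rankOne ℂ (F := Hil s) (basisVec v))
  refine isClosed_compactOps.mem_of_tendsto h (Filter.Eventually.of_forall fun t =>
    Submodule.sum_mem _ fun w _ => ?_)
  rw [map_smulₛₗ]
  exact Submodule.smul_mem _ _ (rankOne_basisVec_mem_compactOps v w)

theorem mul_mem_compactOps_right (a : Hil s →L[ℂ] Hil s) {k : Hil s →L[ℂ] Hil s}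
    (hk : k ∈ compactOps s) : k * a ∈ compactOps s := by
  refine map_mem_of_forall_mem ((ContinuousLinearMap.mul ℂ _).flip a) isClosed_compactOps ?_ hk
  rintro _ ⟨⟨v, w⟩, rfl⟩
  show _ * a ∈ _
  rw [ContinuousLinearMap.mul_def, rankOne_comp]
  exact rankOne_mem_compactOps_right _ _

variable [NeZero s]

/-- The operators `M_F W^m (W⋆)^n` with `F` in `funcF s`, and the matrix units. -/
def spanningSet (s : ℕ) [NeZero s] : Set (Hil s →L[ℂ] Hil s) :=
  {T | ∃ F : lp (fun _ : Vertex s => ℂ) ∞, ⇑F ∈ funcF s ∧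
      ∃ m n : ℕ, T = diagOp F * W s ^ m * star (W s) ^ n} ∪
    Set.range fun p : Vertex s × Vertex s => rankOne ℂ (basisVec p.1) (basisVec p.2)

/-- The closed span is not shown to be an algebra. It suffices that it contains `1` and is stable
under left multiplication by the generators and their adjoints. -/
theorem algA_le_closure_span :
    (algA s : Set (Hil s →L[ℂ] Hil s)) ⊆ (Submodule.span ℂ (spanningSet s)).topologicalClosure := by
  set S := (Submodule.span ℂ (spanningSet s)).topologicalClosure with hS
  have hcl : IsClosed (S : Set (Hil s →L[ℂ] Hil s)) := Submodule.isClosed_topologicalClosure _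
  have hK : compactOps s ≤ S :=
    Submodule.topologicalClosure_mono (Submodule.span_mono Set.subset_union_right)
  have hgen : ∀ {F : lp (fun _ : Vertex s => ℂ) ∞}, ⇑F ∈ funcF s → ∀ m n : ℕ,
      diagOp F * W s ^ m * star (W s) ^ n ∈ S := fun {F} hF m n =>
    Submodule.le_topologicalClosure _ (Submodule.subset_span (Or.inl ⟨F, hF, m, n, rfl⟩))
  have key : ∀ x : Hil s →L[ℂ] Hil s, (∀ (F : lp (fun _ : Vertex s => ℂ) ∞), ⇑F ∈ funcF s →
      ∀ m n : ℕ, x * (diagOp F * W s ^ m * star (W s) ^ n) ∈ S) → ∀ t ∈ S, x * t ∈ S := by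
    intro x hx t ht
    refine map_mem_of_forall_mem (ContinuousLinearMap.mul ℂ _ x) hcl ?_ ht
    rintro _ (⟨F, hF, m, n, rfl⟩ | ⟨⟨v, w⟩, rfl⟩)
    · exact hx F hF m n
    · exact hK (mul_mem_compactOps_left x (rankOne_basisVec_mem_compactOps v w))
  have hdiag : ∀ (f : C(SAdic s, ℂ)), ∀ t ∈ S, diagOp (pullback f) * t ∈ S := by
    refine fun f => key _ fun F hF m n => ?_
    rw [← mul_assoc, ← mul_assoc, ← diagOp_mul]
    exact hgen (pullback_mul_mem_funcF f hF) m n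
  have hW : ∀ t ∈ S, W s * t ∈ S := by
    refine key _ fun F hF m n => ?_
    rw [← mul_assoc, ← mul_assoc, W_mul_diagOp, mul_assoc (diagOp _), ← pow_succ']
    exact hgen (shiftFun_mem_funcF hF) _ _
  have hW' : ∀ t ∈ S, star (W s) * t ∈ S := by
    refine key _ fun F hF m n => ?_
    -- Moving `W⋆` past `M_F` exactly requires `F ∘ parent`; replacing it by `F` costs a term in the
    -- ideal `compactOps`.
    have h1 : star (W s) * diagOp F = diagOp F * star (W s) +
        star (W s) * diagOp (F - shiftFun F) := by
      rw [diagOp_sub, mul_sub, star_W_mul_diagOp_shiftFun]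
      abel
    have hc : diagOp (F - shiftFun F) ∈ compactOps s :=
      diagOp_mem_of_tendsto isClosed_compactOps
        (fun v => rankOne_basisVec_mem_compactOps v v) (shiftFun_sub_tendsto hF)
    rw [← mul_assoc, ← mul_assoc, h1, add_mul, add_mul]
    refine add_mem ?_ (hK (mul_mem_compactOps_right _ (mul_mem_compactOps_right _
      (mul_mem_compactOps_left _ hc))))
    cases m with
    | zero =>
      rw [pow_zero, mul_one, mul_assoc, ← pow_succ']
      simpa using hgen hF 0 (n + 1)
    | succ m =>
      rw [pow_succ', mul_assoc (diagOp F), ← mul_assoc (star (W s)), W_isometry, one_mul]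
      exact hgen hF m n
  -- Left stability under `x` says nothing about `star x`, so the induction carries both.
  have hadj : ∀ x ∈ StarAlgebra.adjoin ℂ
      (insert (W s) (Set.range fun f : C(SAdic s, ℂ) => diagOp (pullback f))),
      (∀ t ∈ S, x * t ∈ S) ∧ ∀ t ∈ S, star x * t ∈ S := by
    intro x hx
    induction hx using StarAlgebra.adjoin_induction with
    | mem x hx =>
      rcases hx with rfl | ⟨f, rfl⟩
      · exact ⟨hW, hW'⟩
      · refine ⟨hdiag f, ?_⟩
        have : star (diagOp (pullback f)) = diagOp (pullback (star f)) := star_diagOp _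
        rw [this]
        exact hdiag _
    | algebraMap r =>
      refine ⟨fun t ht => ?_, fun t ht => ?_⟩
      · rw [Algebra.algebraMap_eq_smul_one, smul_mul_assoc, one_mul]
        exact S.smul_mem _ ht
      · rw [Algebra.algebraMap_eq_smul_one, star_smul, star_one, smul_mul_assoc, one_mul]
        exact S.smul_mem _ ht
    | add x y _ _ hx hy =>
      refine ⟨fun t ht => ?_, fun t ht => ?_⟩
      · rw [add_mul]
        exact add_mem (hx.1 t ht) (hy.1 t ht)
      · rw [star_add, add_mul]
        exact add_mem (hx.2 t ht) (hy.2 t ht)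
    | mul x y _ _ hx hy =>
      refine ⟨fun t ht => ?_, fun t ht => ?_⟩
      · rw [mul_assoc]
        exact hx.1 _ (hy.1 t ht)
      · rw [star_mul, mul_assoc]
        exact hy.2 _ (hx.2 t ht)
    | star x _ hx => exact ⟨hx.2, by rw [star_star]; exact hx.1⟩
  have hone : (1 : Hil s →L[ℂ] Hil s) ∈ S := by
    simpa [diagOp_one] using hgen one_mem_funcF 0 0
  refine closure_minimal (fun x hx => ?_) hcl
  have := (hadj x hx).1 1 hone
  rwa [mul_one] at this

/-! ### `B_W` is the gauge-invariant subalgebra of `A_W` -/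

theorem isHomogeneous_of_mem_algB {a : Hil s →L[ℂ] Hil s} (ha : a ∈ algB s) :
    IsHomogeneous a 0 := by
  have hW := isHomogeneous_W s
  have hadj : ∀ x ∈ StarAlgebra.adjoin ℂ
      ({T | ∃ F : lp (fun _ : Vertex s => ℂ) ∞, ⇑F ∈ funcF s ∧ T = diagOp F} ∪
        Set.range (projP s)), ∀ θ, gaugeCLM s θ x = x := by
    intro x hx
    induction hx using StarAlgebra.adjoin_induction with
    | mem x hx =>
      have : IsHomogeneous x 0 := by
        rcases hx with ⟨F, -, rfl⟩ | ⟨n, rfl⟩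
        · exact isHomogeneous_diagOp F
        · have hp : ∀ n : ℕ, IsHomogeneous (W s ^ n * star (W s) ^ n) 0 := fun n => by
            simpa using (hW.pow n).mul (hW.star.pow n)
          have : projP s n = W s ^ n * star (W s) ^ n - W s ^ (n + 1) * star (W s) ^ (n + 1) := by
            rw [projP, pow_succ, pow_succ']
            noncomm_ring
          rw [this, isHomogeneous_zero_iff]
          intro θ
          rw [← gaugeCLM_apply, map_sub, gaugeCLM_apply, gaugeCLM_apply,
            isHomogeneous_zero_iff.mp (hp n), isHomogeneous_zero_iff.mp (hp (n + 1))]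
      simpa only [gaugeCLM_apply] using isHomogeneous_zero_iff.mp this
    | algebraMap r =>
      intro θ
      rw [Algebra.algebraMap_eq_smul_one, map_smul, gaugeCLM_apply,
        isHomogeneous_zero_iff.mp isHomogeneous_one]
    | add x y _ _ hx hy => exact fun θ => by rw [map_add, hx, hy]
    | mul x y _ _ hx hy =>
      intro θ
      have hx := hx θ
      have hy := hy θ
      rw [gaugeCLM_apply] at hx hy ⊢
      rw [gauge_mul, hx, hy]
    | star x _ hx =>
      intro θ
      have hx := hx θ
      rw [gaugeCLM_apply] at hx ⊢
      rw [gauge_star, hx]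
  rw [isHomogeneous_zero_iff]
  intro θ
  rw [← gaugeCLM_apply]
  exact closure_minimal (fun x hx => hadj x hx θ)
    (isClosed_eq (gaugeCLM s θ).continuous continuous_id) ha

/-- An element of the span has finitely many degrees, so a large `N` kills all nonzero ones. The
surviving terms are `M_F W^m (W⋆)^m` and matrix units within one level. -/
theorem eventually_gaugeAvg_mem {t : Hil s →L[ℂ] Hil s}
    (ht : t ∈ Submodule.span ℂ (spanningSet s)) :
    ∀ᶠ N : ℕ in Filter.atTop, gaugeAvg s 0 N t ∈ algB s := by
  have hhom : ∀ {x : Hil s →L[ℂ] Hil s} {d : ℤ}, IsHomogeneous x d → (d = 0 → x ∈ algB s) →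
      ∀ᶠ N : ℕ in Filter.atTop, gaugeAvg s 0 N x ∈ algB s := by
    intro x d hx hd
    filter_upwards [Filter.eventually_gt_atTop d.natAbs] with N hN
    rw [gaugeAvg_of_isHomogeneous hx (by rw [sub_zero, Int.abs_eq_natAbs]; exact_mod_cast hN)]
    split_ifs with h
    · exact hd h
    · exact zero_mem _
  induction ht using Submodule.span_induction with
  | mem x hx =>
    rcases hx with ⟨F, hF, m, n, rfl⟩ | ⟨⟨v, w⟩, rfl⟩
    · refine hhom (((isHomogeneous_diagOp F).mul ((isHomogeneous_W s).pow m)).mul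
        ((isHomogeneous_W s).star.pow n)) fun h => ?_
      obtain rfl : m = n := by
        simp at h
        omega
      rw [mul_assoc]
      exact mul_mem (diagOp_mem_algB hF) (W_pow_mul_star_W_pow_mem_algB m)
    · refine hhom (isHomogeneous_rankOne v w) fun h => rankOne_mem_algB (v := v) (w := w) ?_
      exact_mod_cast sub_eq_zero.mp h
  | zero => simp
  | add x y _ _ hx hy =>
    filter_upwards [hx, hy] with N h1 h2
    rw [map_add]
    exact add_mem h1 h2
  | smul c x _ hx =>
    filter_upwards [hx] with N h
    rw [map_smul]
    exact SMulMemClass.smul_mem c h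

theorem mem_algB_iff (hs : 2 ≤ s) {a : Hil s →L[ℂ] Hil s} :
    a ∈ algB s ↔ a ∈ algA s ∧ IsHomogeneous a 0 := by
  refine ⟨fun h => ⟨algB_le_algA hs h, isHomogeneous_of_mem_algB h⟩, fun ⟨h, h0⟩ => ?_⟩
  have hcl : IsClosed (algB s : Set (Hil s →L[ℂ] Hil s)) := inferInstance
  rw [← SetLike.mem_coe, ← hcl.closure_eq, Metric.mem_closure_iff]
  intro ε hε
  obtain ⟨t, ht, hd⟩ := Metric.mem_closure_iff.mp (algA_le_closure_span h) ε hε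
  -- `N > 0` is needed for the average to fix `a`: for `N = 0` it is the zero map.
  obtain ⟨N, hN, hN0⟩ := ((eventually_gaugeAvg_mem ht).and (Filter.eventually_gt_atTop 0)).exists
  refine ⟨_, hN, ?_⟩
  have ha : gaugeAvg s 0 N a = a := by
    rw [gaugeAvg_of_isHomogeneous h0 (by simpa using hN0), if_pos rfl]
  rw [dist_eq_norm] at hd ⊢
  calc ‖a - gaugeAvg s 0 N t‖ = ‖gaugeAvg s 0 N (a - t)‖ := by rw [map_sub, ha]
    _ ≤ ‖a - t‖ := norm_gaugeAvg_le _ _ _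
    _ < ε := hd

end SerreShift

/-! ### Isometric representations of algebras generated by a covariant pair -/

namespace CovariantPair

theorem continuous_starAlgHom {X Y : Type*} [CStarAlgebra X] [CStarAlgebra Y] (Ψ : X →⋆ₐ[ℂ] Y) :
    Continuous Ψ :=
  AddMonoidHomClass.continuous_of_bound Ψ 1 fun x => by
    simpa using NonUnitalStarAlgHom.norm_apply_le Ψ x

section

variable {A X : Type*} [CStarAlgebra A] [CStarAlgebra X] (ι : A →⋆ₐ[ℂ] X) (J : X)

/-- The linear subspace of the elements `(J⋆)^m ι(a) J^n` with `n - m = k` and `m = 0` or `n = 0`. -/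
def gradedPart (k : ℤ) : Submodule ℂ X :=
  LinearMap.range ((LinearMap.mulLeft ℂ (star J ^ (-k).toNat)) ∘ₗ
    (LinearMap.mulRight ℂ (J ^ k.toNat)) ∘ₗ ι.toAlgHom.toLinearMap)

variable {ι J}

theorem mem_gradedPart_iff {k : ℤ} {x : X} : x ∈ gradedPart ι J k ↔
    ∃ a, x = star J ^ (-k).toNat * ι a * J ^ k.toNat := by
  refine exists_congr fun a => ?_
  simp only [LinearMap.comp_apply, LinearMap.mulLeft_apply, LinearMap.mulRight_apply, mul_assoc]
  exact eq_comm

theorem apply_mem_gradedPart_zero (a : A) : ι a ∈ gradedPart ι J 0 :=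
  mem_gradedPart_iff.mpr ⟨a, by simp⟩

theorem mem_gradedPart_zero_iff {x : X} : x ∈ gradedPart ι J 0 ↔ ∃ a, x = ι a := by
  simp [mem_gradedPart_iff]

theorem isometry_mem_gradedPart : J ∈ gradedPart ι J 1 :=
  mem_gradedPart_iff.mpr ⟨1, by simp⟩

theorem star_mem_gradedPart {k : ℤ} {x : X} (hx : x ∈ gradedPart ι J k) :
    star x ∈ gradedPart ι J (-k) := by
  obtain ⟨a, rfl⟩ := mem_gradedPart_iff.mp hx
  exact mem_gradedPart_iff.mpr ⟨star a, by simp [mul_assoc, map_star]⟩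

/-- The sum of the graded parts of degree between `-n` and `n`. -/
def filtration (ι : A →⋆ₐ[ℂ] X) (J : X) (n : ℕ) : Submodule ℂ X :=
  ⨆ k ∈ Finset.Icc (-n : ℤ) n, gradedPart ι J k

theorem gradedPart_le_filtration {k : ℤ} {n : ℕ} (h : |k| ≤ n) :
    gradedPart ι J k ≤ filtration ι J n :=
  le_biSup (gradedPart ι J) (Finset.mem_Icc.mpr (abs_le.mp h))

theorem filtration_mono {m n : ℕ} (h : m ≤ n) : filtration ι J m ≤ filtration ι J n :=
  iSup₂_le fun k hk => gradedPart_le_filtration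
    ((abs_le.mpr (Finset.mem_Icc.mp hk)).trans (by exact_mod_cast h))

theorem star_mem_filtration {n : ℕ} {x : X} (hx : x ∈ filtration ι J n) :
    star x ∈ filtration ι J n := by
  obtain ⟨c, rfl⟩ := (Submodule.mem_iSup_finset_iff_exists_sum _ _).mp hx
  rw [star_sum]
  refine Submodule.sum_mem _ fun k hk => ?_
  refine gradedPart_le_filtration (k := -k) ?_ (star_mem_gradedPart (c k).2)
  rw [abs_neg]
  exact abs_le.mpr (Finset.mem_Icc.mp hk)

variable {α : A →⋆ₙₐ[ℂ] A} (hJ : star J * J = 1) (hα : ∀ a, ι (α a) = J * ι a * star J)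

include hα

theorem isometry_pow_mul_star (n : ℕ) : ∃ e, J ^ n * star J ^ n = ι e := by
  induction n with
  | zero => exact ⟨1, by simp⟩
  | succ n ih =>
    obtain ⟨e, he⟩ := ih
    refine ⟨α e, ?_⟩
    rw [hα, ← he, pow_succ', pow_succ]
    noncomm_ring

include hJ

theorem isometry_mul (a : A) : J * ι a = ι (α a) * J := by
  rw [hα, mul_assoc, hJ, mul_one]

theorem isometry_pow_mul (n : ℕ) (a : A) : J ^ n * ι a = ι (α^[n] a) * J ^ n := by
  induction n generalizing a with
  | zero => simp
  | succ n ih =>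
    rw [pow_succ, mul_assoc, isometry_mul hJ hα, ← mul_assoc, ih, mul_assoc, ← pow_succ,
      Function.iterate_succ_apply]

theorem mul_star_isometry_pow (n : ℕ) (a : A) :
    ι a * star J ^ n = star J ^ n * ι (α^[n] a) := by
  have h := congrArg star (isometry_pow_mul hJ hα n (star a))
  have hs : ∀ n : ℕ, α^[n] (star a) = star (α^[n] a) := fun n => by
    induction n with
    | zero => rfl
    | succ n ih => rw [Function.iterate_succ_apply', Function.iterate_succ_apply', ih, map_star]
  rwa [star_mul, star_mul, star_pow, ← map_star, ← map_star, hs, star_star, star_star] at h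

variable {β : A → A} (hβ : ∀ a, α (β a) = α 1 * a * α 1)

include hβ

/-- By `hβ` the corner `α(1) A α(1)` lies in the range of `α`. Inserting `J⋆ J = 1` on both sides
turns `ι a` into its compression by `J J⋆ = ι(α 1)`, which is `J ι(β a) J⋆`. -/
theorem star_isometry_mul_mul (a : A) : star J * ι a * J = ι (β a) := by
  have h := hα (β a)
  rw [hβ, map_mul, map_mul, hα, map_one, mul_one] at h
  calc star J * ι a * J = (star J * J) * (star J * ι a * J) * (star J * J) := by
        rw [hJ, one_mul, mul_one]
    _ = star J * (J * star J * ι a * (J * star J)) * J := by noncomm_ring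
    _ = (star J * J) * ι (β a) * (star J * J) := by rw [h]; noncomm_ring
    _ = ι (β a) := by rw [hJ, one_mul, mul_one]

/-- Inner pairs `J⋆ · J` are absorbed into `A` through `β` until one exponent is zero. -/
theorem mul_mul_mem_gradedPart (m n : ℕ) (a : A) :
    star J ^ m * ι a * J ^ n ∈ gradedPart ι J ((n : ℤ) - m) := by
  induction m generalizing n a with
  | zero => exact mem_gradedPart_iff.mpr ⟨a, by simp⟩
  | succ m ih =>
    cases n with
    | zero =>
      have h1 : (-((0 : ℕ) - (m + 1 : ℕ) : ℤ)).toNat = m + 1 := by omega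
      have h2 : ((0 : ℕ) - (m + 1 : ℕ) : ℤ).toNat = 0 := by omega
      exact mem_gradedPart_iff.mpr ⟨a, by rw [h1, h2]⟩
    | succ n =>
      have : star J ^ (m + 1) * ι a * J ^ (n + 1) = star J ^ m * ι (β a) * J ^ n := by
        rw [← star_isometry_mul_mul hJ hα hβ, pow_succ, pow_succ']
        noncomm_ring
      rw [this]
      convert ih n (β a) using 2
      push_cast
      ring

/-- In the middle factor `J^n (J⋆)^p` the common power is an element of `ι(A)`. The surplus is moved
outwards by the commutation rules: `J⋆` to the left, `J` to the right. -/
theorem mul_mem_gradedPart {k l : ℤ} {x y : X} (hx : x ∈ gradedPart ι J k)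
    (hy : y ∈ gradedPart ι J l) : x * y ∈ gradedPart ι J (k + l) := by
  obtain ⟨a, rfl⟩ := mem_gradedPart_iff.mp hx
  obtain ⟨b, rfl⟩ := mem_gradedPart_iff.mp hy
  have hk : ((k.toNat : ℤ) - (-k).toNat) = k := Int.toNat_sub_toNat_neg k
  have hl : ((l.toNat : ℤ) - (-l).toNat) = l := Int.toNat_sub_toNat_neg l
  generalize k.toNat = n at *
  generalize (-k).toNat = m at *
  generalize l.toNat = q at *
  generalize (-l).toNat = p at *
  rcases le_total n p with h | h
  · obtain ⟨r, rfl⟩ := Nat.exists_eq_add_of_le h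
    obtain ⟨e, he⟩ := isometry_pow_mul_star hα n
    have : star J ^ m * ι a * J ^ n * (star J ^ (n + r) * ι b * J ^ q) =
        star J ^ (m + r) * ι (α^[r] (a * e) * b) * J ^ q := by
      calc _ = star J ^ m * (ι a * (J ^ n * star J ^ n) * star J ^ r) * ι b * J ^ q := by
            rw [pow_add]; noncomm_ring
        _ = _ := by
            rw [he, ← map_mul, mul_star_isometry_pow hJ hα, map_mul ι (α^[r] (a * e)), pow_add]
            noncomm_ring
    rw [this]
    convert mul_mul_mem_gradedPart hJ hα hβ (m + r) q (α^[r] (a * e) * b) using 2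
    omega
  · obtain ⟨r, rfl⟩ := Nat.exists_eq_add_of_le h
    obtain ⟨e, he⟩ := isometry_pow_mul_star hα p
    have : star J ^ m * ι a * J ^ (p + r) * (star J ^ p * ι b * J ^ q) =
        star J ^ m * ι (a * α^[r] (e * b)) * J ^ (r + q) := by
      calc _ = star J ^ m * ι a * (J ^ r * ((J ^ p * star J ^ p) * ι b)) * J ^ q := by
            rw [add_comm p r, pow_add]; noncomm_ring
        _ = _ := by
            rw [he, ← map_mul, isometry_pow_mul hJ hα, map_mul ι a, pow_add]
            noncomm_ring
    rw [this]
    convert mul_mul_mem_gradedPart hJ hα hβ m (r + q) (a * α^[r] (e * b)) using 2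
    omega

theorem mul_mem_filtration {m n : ℕ} {x y : X} (hx : x ∈ filtration ι J m)
    (hy : y ∈ filtration ι J n) : x * y ∈ filtration ι J (m + n) := by
  obtain ⟨c, rfl⟩ := (Submodule.mem_iSup_finset_iff_exists_sum _ _).mp hx
  obtain ⟨d, rfl⟩ := (Submodule.mem_iSup_finset_iff_exists_sum _ _).mp hy
  rw [Finset.sum_mul_sum]
  refine Submodule.sum_mem _ fun k hk => Submodule.sum_mem _ fun l hl => ?_
  refine gradedPart_le_filtration (k := k + l) ?_ (mul_mem_gradedPart hJ hα hβ (c k).2 (d l).2)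
  rw [Finset.mem_Icc] at hk hl
  rw [abs_le]
  push_cast
  constructor <;> linarith

theorem pow_mem_filtration {n : ℕ} {x : X} (hx : x ∈ filtration ι J n) (N : ℕ) :
    x ^ N ∈ filtration ι J (N * n) := by
  induction N with
  | zero =>
    refine gradedPart_le_filtration (k := 0) (by simp) ?_
    simpa using apply_mem_gradedPart_zero (ι := ι) (J := J) 1
  | succ N ih =>
    rw [pow_succ, add_mul, one_mul]
    exact mul_mem_filtration hJ hα hβ ih hx

theorem exists_mem_filtration {x : X}
    (hx : x ∈ StarAlgebra.adjoin ℂ (insert J (Set.range ι))) : ∃ n, x ∈ filtration ι J n := by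
  induction hx using StarAlgebra.adjoin_induction with
  | mem x hx =>
    rcases hx with rfl | ⟨a, rfl⟩
    · exact ⟨1, gradedPart_le_filtration (k := 1) (by simp) isometry_mem_gradedPart⟩
    · exact ⟨0, gradedPart_le_filtration (k := 0) (by simp) (apply_mem_gradedPart_zero a)⟩
  | algebraMap r =>
    refine ⟨0, gradedPart_le_filtration (k := 0) (by simp) ?_⟩
    rw [← AlgHomClass.commutes ι r]
    exact apply_mem_gradedPart_zero _
  | add x y _ _ hx hy =>
    obtain ⟨m, hm⟩ := hx
    obtain ⟨n, hn⟩ := hy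
    exact ⟨max m n, add_mem (filtration_mono (le_max_left _ _) hm)
      (filtration_mono (le_max_right _ _) hn)⟩
  | mul x y _ _ hx hy =>
    obtain ⟨m, hm⟩ := hx
    obtain ⟨n, hn⟩ := hy
    exact ⟨m + n, mul_mem_filtration hJ hα hβ hm hn⟩
  | star x _ hx =>
    obtain ⟨n, hn⟩ := hx
    exact ⟨n, star_mem_filtration hn⟩

variable {Y : Type*} [CStarAlgebra Y] {Ψ : X →⋆ₐ[ℂ] Y} (hι : ∀ a, ‖Ψ (ι a)‖ = ‖a‖)

include hι

/-- `x⋆ x` has degree zero, hence lies in `ι(A)`, where `Ψ` is isometric; the C⋆-identity does the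
rest. -/
theorem norm_map_of_mem_gradedPart {k : ℤ} {x : X} (hx : x ∈ gradedPart ι J k) :
    ‖Ψ x‖ = ‖x‖ := by
  have h := mul_mem_gradedPart hJ hα hβ (star_mem_gradedPart hx) hx
  rw [neg_add_cancel] at h
  obtain ⟨a, ha⟩ := mem_gradedPart_zero_iff.mp h
  have h1 : ‖ι a‖ = ‖a‖ := le_antisymm (NonUnitalStarAlgHom.norm_apply_le ι a)
    ((hι a).symm.le.trans (NonUnitalStarAlgHom.norm_apply_le Ψ (ι a)))
  have h2 : ‖Ψ x‖ * ‖Ψ x‖ = ‖x‖ * ‖x‖ := by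
    rw [← CStarRing.norm_star_mul_self, ← CStarRing.norm_star_mul_self, ← map_star, ← map_mul, ha,
      hι, h1]
  exact (mul_self_inj (norm_nonneg _) (norm_nonneg _)).mp h2

variable (hE : ∀ (n : ℕ) (k : ℤ), ∃ E : Y →ₗ[ℂ] Y, (∀ y, ‖E y‖ ≤ ‖y‖) ∧
  ∀ d : ℤ, |d| ≤ n → ∀ x ∈ gradedPart ι J d, E (Ψ x) = if d = k then Ψ x else 0)

include hE

/-- Each of the `2n + 1` components is bounded by `‖Ψ x‖`, being recovered from `Ψ x` by a
contraction. What matters later is that the constant grows only linearly in `n`. -/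
theorem norm_le_of_mem_filtration {n : ℕ} {x : X} (hx : x ∈ filtration ι J n) :
    ‖x‖ ≤ (2 * n + 1) * ‖Ψ x‖ := by
  obtain ⟨c, rfl⟩ := (Submodule.mem_iSup_finset_iff_exists_sum _ _).mp hx
  refine (norm_sum_le_of_le _ (f := fun k => (c k : X)) (fun k hk => ?_ : ∀ k ∈ _, _ ≤
    ‖Ψ (∑ k ∈ Finset.Icc (-n : ℤ) n, (c k : X))‖)).trans_eq ?_
  · obtain ⟨E, hE1, hE2⟩ := hE n k
    rw [← norm_map_of_mem_gradedPart hJ hα hβ hι (c k).2]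
    have : E (Ψ (∑ k ∈ Finset.Icc (-n : ℤ) n, (c k : X))) = Ψ (c k) := by
      rw [map_sum, map_sum, Finset.sum_eq_single k]
      · rw [hE2 k (abs_le.mpr (Finset.mem_Icc.mp hk)) _ (c k).2, if_pos rfl]
      · intro d hd hdk
        rw [hE2 d (abs_le.mpr (Finset.mem_Icc.mp hd)) _ (c d).2, if_neg hdk]
      · exact fun h => absurd hk h
    rw [← this]
    exact hE1 _
  · rw [Finset.sum_const, nsmul_eq_mul, Int.card_Icc]
    congr 1
    have : ((n : ℤ) + 1 - -n).toNat = 2 * n + 1 := by omega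
    rw [this]
    push_cast
    ring

/-- The crude estimate is applied to `x^(2^m)`, whose degrees are bounded by `2^m n` and whose norm
is `‖x‖^(2^m)`. If `q = ‖Ψ x‖ / ‖x‖` were less than `1`, the exponential decay of `q^(2^m)` would
beat the linear factor. -/
theorem norm_le_of_mem_filtration_of_isSelfAdjoint {n : ℕ} {x : X} (hx : x ∈ filtration ι J n)
    (hsa : IsSelfAdjoint x) : ‖x‖ ≤ ‖Ψ x‖ := by
  by_contra! hlt
  have hx0 : 0 < ‖x‖ := (norm_nonneg _).trans_lt hlt
  set q := ‖Ψ x‖ / ‖x‖ with hq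
  have hq0 : 0 ≤ q := by positivity
  have hq1 : q < 1 := (div_lt_one hx0).mpr hlt
  have hbound : ∀ m : ℕ, 1 ≤ (2 * n) * (((2 ^ m : ℕ) : ℝ) * q ^ 2 ^ m) + q ^ 2 ^ m := by
    intro m
    have h1 := norm_le_of_mem_filtration hJ hα hβ hι hE (pow_mem_filtration hJ hα hβ hx (2 ^ m))
    rw [map_pow, hsa.norm_pow_two_pow, (hsa.map Ψ).norm_pow_two_pow] at h1
    have h2 : q ^ 2 ^ m = ‖Ψ x‖ ^ 2 ^ m / ‖x‖ ^ 2 ^ m := div_pow _ _ _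
    have h3 : (1 : ℝ) ≤ ((2 * ((2 ^ m * n : ℕ) : ℝ) + 1) * ‖Ψ x‖ ^ 2 ^ m) / ‖x‖ ^ 2 ^ m :=
      (one_le_div (pow_pos hx0 _)).mpr h1
    calc (1 : ℝ) ≤ _ := h3
      _ = _ := by
        rw [h2]
        push_cast
        ring
  have hpow : Filter.Tendsto (fun m : ℕ => 2 ^ m) Filter.atTop Filter.atTop :=
    tendsto_pow_atTop_atTop_of_one_lt (by norm_num)
  have hlim := (((tendsto_self_mul_const_pow_of_lt_one hq0 hq1).comp hpow).const_mul
    (2 * n : ℝ)).add ((tendsto_pow_atTop_nhds_zero_of_lt_one hq0 hq1).comp hpow)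
  rw [mul_zero, add_zero] at hlim
  exact absurd (ge_of_tendsto' hlim hbound) (by norm_num)

/-- If `Ψ` is isometric on `ι(A)` and the components of an element can be recovered from its image
by contractive maps, then `Ψ` is isometric on the C⋆-algebra generated by `ι(A)` and `J`. -/
theorem norm_map_of_mem_closure {x : X}
    (hx : x ∈ (StarAlgebra.adjoin ℂ (insert J (Set.range ι))).topologicalClosure) :
    ‖Ψ x‖ = ‖x‖ := by
  refine closure_minimal (t := {x | ‖Ψ x‖ = ‖x‖}) (fun x hx => ?_) ?_ hx
  · refine le_antisymm (NonUnitalStarAlgHom.norm_apply_le Ψ x) ?_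
    obtain ⟨n, hn⟩ := exists_mem_filtration hJ hα hβ hx
    have h := norm_le_of_mem_filtration_of_isSelfAdjoint hJ hα hβ hι hE
      (mul_mem_filtration hJ hα hβ (star_mem_filtration hn) hn) (IsSelfAdjoint.star_mul_self x)
    rw [map_mul, map_star, CStarRing.norm_star_mul_self, CStarRing.norm_star_mul_self] at h
    exact (mul_self_le_mul_self_iff (norm_nonneg _) (norm_nonneg _)).mpr h
  · exact isClosed_eq (continuous_starAlgHom Ψ).norm continuous_norm

end

/-- A ⋆-homomorphism which is isometric on the C⋆-algebra `S` generated by `s` and maps generators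
of `S` to generators of a C⋆-algebra `T` restricts to an isomorphism of `S` and `T`. -/
theorem exists_starAlgEquiv_of_norm_map {X Y : Type*} [CStarAlgebra X] [CStarAlgebra Y]
    (Ψ : X →⋆ₐ[ℂ] Y) {s : Set X} {S : StarSubalgebra ℂ X} {T : StarSubalgebra ℂ Y}
    (hS : S = (StarAlgebra.adjoin ℂ s).topologicalClosure)
    (hT : T = (StarAlgebra.adjoin ℂ (Ψ '' s)).topologicalClosure)
    (hΨ : ∀ x ∈ S, ‖Ψ x‖ = ‖x‖) :
    ∃ Φ : T ≃⋆ₐ[ℂ] S, ∀ (y : T) (x : S), (y : Y) = Ψ x → Φ y = x := by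
  have hScl : IsClosed (S : Set X) := by
    rw [hS]
    exact StarSubalgebra.isClosed_topologicalClosure _
  have hTcl : IsClosed (T : Set Y) := by
    rw [hT]
    exact StarSubalgebra.isClosed_topologicalClosure _
  have hmem : ∀ x ∈ S, Ψ x ∈ T := by
    have : S ≤ T.comap Ψ := by
      rw [hS]
      refine StarSubalgebra.topologicalClosure_minimal (StarAlgebra.adjoin_le fun x hx => ?_)
        (hTcl.preimage (continuous_starAlgHom Ψ))
      show Ψ x ∈ T
      rw [hT]
      exact StarSubalgebra.le_topologicalClosure _ (StarAlgebra.subset_adjoin ℂ _ ⟨x, hx, rfl⟩)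
    exact fun x hx => this hx
  let f : S →⋆ₐ[ℂ] T := (Ψ.comp S.subtype).codRestrict T fun x => hmem x x.2
  have hf : Isometry f := AddMonoidHomClass.isometry_of_norm f fun x => hΨ x x.2
  have hg : Isometry (Ψ.comp S.subtype) :=
    AddMonoidHomClass.isometry_of_norm (Ψ.comp S.subtype) fun x => hΨ x x.2
  have hsurj : Function.Surjective f := by
    -- An isometric image of a complete space is closed, so it contains the closure of what the
    -- images of the generators generate.
    have : CompleteSpace S := hScl.completeSpace_coe
    have hle : T ≤ (Ψ.comp S.subtype).range := by
      rw [hT]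
      refine StarSubalgebra.topologicalClosure_minimal (StarAlgebra.adjoin_le ?_) ?_
      · rintro _ ⟨x, hx, rfl⟩
        have hxS : x ∈ S := by
          rw [hS]
          exact StarSubalgebra.le_topologicalClosure _ (StarAlgebra.subset_adjoin ℂ _ hx)
        exact ⟨⟨x, hxS⟩, rfl⟩
      · exact hg.isClosedEmbedding.isClosed_range
    intro y
    obtain ⟨x, hx⟩ := hle y.2
    exact ⟨x, Subtype.ext hx⟩
  refine ⟨(StarAlgEquiv.ofBijective f ⟨hf.injective, hsurj⟩).symm, fun y x h => ?_⟩
  have hy : y = f x := Subtype.ext h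
  rw [hy]
  exact (StarAlgEquiv.ofBijective f ⟨hf.injective, hsurj⟩).symm_apply_apply x

end CovariantPair

/-! ### The crossed product and evaluation at a covariant representation -/

namespace CrossedProduct

variable {A : Type u} [CStarAlgebra A] (α : A →⋆ₙₐ[ℂ] A)

/-- `iotaFun` as a ⋆-homomorphism. -/
def iotaHom : A →⋆ₐ[ℂ] Ambient α where
  toFun := iotaFun α
  map_one' := by ext r; exact map_one r.π
  map_mul' a b := by ext r; exact map_mul r.π a b
  map_zero' := by ext r; exact map_zero r.π
  map_add' a b := by ext r; exact map_add r.π a b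
  commutes' c := by ext r; exact AlgHomClass.commutes r.π c
  map_star' a := by ext r; exact map_star r.π a

/-- The projection onto the target of a covariant representation. -/
def evalHom (r : CovariantRep α) : Ambient α →⋆ₐ[ℂ] r.C where
  toFun x := x r
  map_one' := rfl
  map_mul' _ _ := rfl
  map_zero' := rfl
  map_add' _ _ := rfl
  commutes' _ := rfl
  map_star' _ := rfl

theorem star_isoElem_mul_isoElem : star (isoElem α) * isoElem α = 1 := by
  ext r
  exact r.isometry

theorem iotaHom_apply_endomorphism (a : A) :
    iotaHom α (α a) = isoElem α * iotaHom α a * star (isoElem α) := by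
  ext r
  exact r.covariant a

open CovariantPair in
/-- A covariant representation which is isometric on `A` and has contractive projections onto its
homogeneous components induces an isomorphism of the C⋆-algebra it generates and the crossed
product. -/
theorem exists_starAlgEquiv {C : Type u} [CStarAlgebra C] [Nontrivial C] (π : A →⋆ₐ[ℂ] C) (J : C)
    (hJ : star J * J = 1) (hα : ∀ a, π (α a) = J * π a * star J)
    (hα' : ∀ a, ∃ b, α b = α 1 * a * α 1) (hπ : ∀ a, ‖π a‖ = ‖a‖)
    (hE : ∀ (N : ℕ) (k : ℤ), ∃ E : C →ₗ[ℂ] C, (∀ y, ‖E y‖ ≤ ‖y‖) ∧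
      ∀ (m n : ℕ) (a : A), |(n : ℤ) - m| ≤ N →
        E (star J ^ m * π a * J ^ n) = if (n : ℤ) - m = k then star J ^ m * π a * J ^ n else 0)
    (T : StarSubalgebra ℂ C)
    (hT : T = (StarAlgebra.adjoin ℂ (insert J (Set.range π))).topologicalClosure) :
    ∃ Φ : T ≃⋆ₐ[ℂ] CrossedProduct α, (∀ (y : T) (a : A), (y : C) = π a → Φ y = iota α a) ∧
      ∀ y : T, (y : C) = J → Φ y = iso α := by
  choose β hβ using hα'
  -- The given pair is one of the factors of the product defining the crossed product, so the
  -- comparison map is a coordinate projection.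
  let r : CovariantRep α := { C := C, π := π, J := J, isometry := hJ, covariant := hα }
  let Ψ : Ambient α →⋆ₐ[ℂ] C := evalHom α r
  have hΨι : ∀ a, Ψ (iotaHom α a) = π a := fun _ => rfl
  have hΨJ : Ψ (isoElem α) = J := rfl
  have hnorm : ∀ x ∈ CrossedProduct.algebra α, ‖Ψ x‖ = ‖x‖ := by
    refine fun x hx => norm_map_of_mem_closure (ι := iotaHom α) (J := isoElem α)
      (star_isoElem_mul_isoElem α) (iotaHom_apply_endomorphism α) hβ (Ψ := Ψ) hπ ?_ hx
    intro N k
    obtain ⟨E, hE1, hE2⟩ := hE N k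
    refine ⟨E, hE1, fun d hd x hx => ?_⟩
    obtain ⟨a, rfl⟩ := mem_gradedPart_iff.mp hx
    have hdk : ((d.toNat : ℤ) - (-d).toNat) = d := Int.toNat_sub_toNat_neg d
    have := hE2 (-d).toNat d.toNat a (by rwa [hdk])
    rw [hdk] at this
    have hx : Ψ (star (isoElem α) ^ (-d).toNat * iotaHom α a * isoElem α ^ d.toNat) =
        star J ^ (-d).toNat * π a * J ^ d.toNat := by
      rw [map_mul, map_mul, map_pow, map_pow, map_star, hΨι, hΨJ]
    rw [hx]
    exact this
  have himage : Ψ '' insert (isoElem α) (Set.range (iotaFun α)) = insert J (Set.range π) := by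
    rw [Set.image_insert_eq, ← Set.range_comp]
    rfl
  obtain ⟨Φ, hΦ⟩ := exists_starAlgEquiv_of_norm_map Ψ (S := CrossedProduct.algebra α) rfl
    (hT.trans (by rw [himage])) hnorm
  exact ⟨Φ, fun y a h => hΦ y (iota α a) h, fun y h => hΦ y (iso α) h⟩

end CrossedProduct

namespace SerreShift

/-! ### The crossed product of `B_W` -/

variable {s : ℕ} [NeZero s]

/-- Gauge invariance makes this a count of degrees, `1 + 0 - 1 = 0`, with no computation on
generators. -/
theorem W_mul_mul_star_W_mem_algB (hs : 2 ≤ s) {b : Hil s →L[ℂ] Hil s} (hb : b ∈ algB s) :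
    W s * b * star (W s) ∈ algB s := by
  have hb' := (mem_algB_iff hs).mp hb
  refine (mem_algB_iff hs).mpr ⟨mul_mem (mul_mem (W_mem_algA s) hb'.1) (star_mem (W_mem_algA s)), ?_⟩
  simpa using ((isHomogeneous_W s).mul hb'.2).mul (isHomogeneous_W s).star

theorem star_W_mul_mul_W_mem_algB (hs : 2 ≤ s) {b : Hil s →L[ℂ] Hil s} (hb : b ∈ algB s) :
    star (W s) * b * W s ∈ algB s := by
  have hb' := (mem_algB_iff hs).mp hb
  refine (mem_algB_iff hs).mpr ⟨mul_mem (mul_mem (star_mem (W_mem_algA s)) hb'.1) (W_mem_algA s), ?_⟩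
  simpa using ((isHomogeneous_W s).star.mul hb'.2).mul (isHomogeneous_W s)

/-- The endomorphism `b ↦ W b W⋆` of `B_W`. -/
def endB (hs : 2 ≤ s) : algB s →⋆ₙₐ[ℂ] algB s where
  toFun b := ⟨W s * b * star (W s), W_mul_mul_star_W_mem_algB hs b.2⟩
  map_smul' c b := Subtype.ext (by simp)
  map_zero' := Subtype.ext (by simp)
  map_add' a b := Subtype.ext (by simp [mul_add, add_mul])
  map_mul' a b := Subtype.ext (by
    have h : W s * (a * b) * star (W s) =
        W s * a * (star (W s) * W s) * b * star (W s) := by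
      rw [W_isometry]
      noncomm_ring
    simp only [MulMemClass.coe_mul]
    rw [h]
    noncomm_ring)
  map_star' b := Subtype.ext (by simp [mul_assoc])

theorem coe_endB (hs : 2 ≤ s) (b : algB s) :
    (endB hs b : Hil s →L[ℂ] Hil s) = W s * b * star (W s) := rfl

/-- This makes `B(H)` nontrivial, as the target of a covariant representation must be. -/
instance : Nontrivial (Hil s) :=
  ⟨basisVec ⟨0, ⟨0, by simp⟩⟩, 0, fun h => by
    have := norm_basisVec (s := s) ⟨0, ⟨0, by simp⟩⟩
    rw [h, norm_zero] at this
    exact zero_ne_one this⟩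

theorem algA_eq_closure_adjoin (hs : 2 ≤ s) : algA s =
    (StarAlgebra.adjoin ℂ (insert (W s) (Set.range (algB s).subtype))).topologicalClosure := by
  refine le_antisymm (StarSubalgebra.topologicalClosure_mono (StarAlgebra.adjoin_le ?_))
    (StarSubalgebra.topologicalClosure_minimal (StarAlgebra.adjoin_le ?_)
      (StarSubalgebra.isClosed_topologicalClosure _))
  · rintro _ (rfl | ⟨f, rfl⟩)
    · exact StarAlgebra.subset_adjoin ℂ _ (Set.mem_insert _ _)
    · exact StarAlgebra.subset_adjoin ℂ _ (Set.mem_insert_of_mem _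
        ⟨⟨_, diagOp_mem_algB (pullback_mem_funcF f)⟩, rfl⟩)
  · rintro _ (rfl | ⟨b, rfl⟩)
    · exact W_mem_algA s
    · exact algB_le_algA hs b.2

/-- The witness is `W⋆ b W`, since `endB hs 1 = W W⋆`. -/
theorem exists_endB_eq (hs : 2 ≤ s) (b : algB s) :
    ∃ c, endB hs c = endB hs 1 * b * endB hs 1 :=
  ⟨⟨star (W s) * b * W s, star_W_mul_mul_W_mem_algB hs b.2⟩, Subtype.ext (by
    simp only [coe_endB, MulMemClass.coe_mul, OneMemClass.coe_one]
    noncomm_ring)⟩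

/-- The order `N + |k| + 1` exceeds `|d - k|` for every degree `d` with `|d| ≤ N`, so one average
separates all these degrees from `k`. -/
theorem gaugeAvg_component {b : Hil s →L[ℂ] Hil s} (hb : b ∈ algB s) {m n N : ℕ} (k : ℤ)
    (h : |(n : ℤ) - m| ≤ N) :
    gaugeAvg s k (N + k.natAbs + 1) (star (W s) ^ m * b * W s ^ n) =
      if (n : ℤ) - m = k then star (W s) ^ m * b * W s ^ n else 0 := by
  have hd : IsHomogeneous (star (W s) ^ m * b * W s ^ n) ((n : ℤ) - m) := by
    convert (((isHomogeneous_W s).star.pow m).mul (isHomogeneous_of_mem_algB hb)).mul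
      ((isHomogeneous_W s).pow n) using 1
    ring
  refine gaugeAvg_of_isHomogeneous hd ?_
  rw [abs_le] at h
  rw [abs_lt]
  push_cast [Int.natCast_natAbs]
  constructor <;> linarith [le_abs_self k, neg_abs_le k]

end SerreShift

end

/-! ### The main theorem -/

theorem mainTheorem5 (s : ℕ) [NeZero s] (hs : 2 ≤ s) :
    (∀ a : SerreShift.Hil s →L[ℂ] SerreShift.Hil s,
      a ∈ SerreShift.algB s ↔ a ∈ SerreShift.algA s ∧ ∀ θ : ℝ, SerreShift.gauge s θ a = a) ∧
    ∃ α : SerreShift.algB s →⋆ₙₐ[ℂ] SerreShift.algB s,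
      (∀ b : SerreShift.algB s,
        (α b : SerreShift.Hil s →L[ℂ] SerreShift.Hil s) =
          SerreShift.W s * b * star (SerreShift.W s)) ∧
      ∃ Φ : SerreShift.algA s ≃⋆ₐ[ℂ] CrossedProduct α,
        (∀ (a : SerreShift.algA s) (b : SerreShift.algB s),
          (a : SerreShift.Hil s →L[ℂ] SerreShift.Hil s) = b → Φ a = CrossedProduct.iota α b) ∧
        Φ ⟨SerreShift.W s, SerreShift.W_mem_algA s⟩ = CrossedProduct.iso α := by
  refine ⟨fun a => by rw [SerreShift.mem_algB_iff hs, SerreShift.isHomogeneous_zero_iff],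
    SerreShift.endB hs, SerreShift.coe_endB hs, ?_⟩
  have hE : ∀ (N : ℕ) (k : ℤ), ∃ E : (SerreShift.Hil s →L[ℂ] SerreShift.Hil s) →ₗ[ℂ]
      (SerreShift.Hil s →L[ℂ] SerreShift.Hil s), (∀ y, ‖E y‖ ≤ ‖y‖) ∧
      ∀ (m n : ℕ) (b : SerreShift.algB s), |(n : ℤ) - m| ≤ N →
        E (star (SerreShift.W s) ^ m * (SerreShift.algB s).subtype b * SerreShift.W s ^ n) =
          if (n : ℤ) - m = k then
            star (SerreShift.W s) ^ m * (SerreShift.algB s).subtype b * SerreShift.W s ^ n else 0 :=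
    fun N k => ⟨(SerreShift.gaugeAvg s k (N + k.natAbs + 1)).toLinearMap,
      SerreShift.norm_gaugeAvg_le _ _, fun m n b h => SerreShift.gaugeAvg_component b.2 k h⟩
  have h := CrossedProduct.exists_starAlgEquiv (SerreShift.endB hs)
    (SerreShift.algB s).subtype (SerreShift.W s) (SerreShift.W_isometry s) (SerreShift.coe_endB hs)
    (SerreShift.exists_endB_eq hs) (fun _ => rfl) hE (SerreShift.algA s)
    (SerreShift.algA_eq_closure_adjoin hs)
  obtain ⟨Φ, hΦ, hΦW⟩ := h
  exact ⟨Φ, hΦ, hΦW _ rfl⟩
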